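/- **Setting.** Let $f$ be a real-valued function on $\mathbb R^n$, $h:\mathbb R^n\to(-\infty,\infty]$, $A:\mathbb R^n\to\mathbb R^l$ linear and $b\in\mathbb R^l$; norms are Euclidean, $\|A\|$ is the operator norm. Write $\phi=f+h$, $\phi_c=\phi+\frac c2\|A\cdot-b\|^2$, $\mathcal F=\{z\in\operatorname{dom}h: Az=b\}$. Assume: (A1) $A\neq0$ and $\mathcal F\ne\emptyset$; (A2) $h$ is proper, convex and lower semicontinuous; (A3) $f$ (possibly nonconvex) is differentiable on $\operatorname{dom}h$, and for some $L\ge m>0$ and all $z,z'\in\operatorname{dom}h$: $\|\nabla f(z')-\nabla f(z)\|\le L\|z'-z\|$ and $f(z')-f(z)-\langle\nabla f(z),z'-z\rangle\ge-\frac m2\|z'-z\|^2$; (A4) $\bar c\ge0$ and $\phi^*_{\bar c}:=\inf_{\mathbb R^n}\phi_{\bar c}>-\infty$; (B1) $\bar z\in\operatorname{int}(\operatorname{dom}h)$ and $A\bar z=b$; (B2) for every $\alpha\in\mathbb R$, $D(\alpha):=\sup\{\|x-x'\|:\phi_{\bar c}(x)\le\alpha,\ \phi_{\bar c}(x')\le\alpha\}<\infty$;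 (B3) for every $\alpha\in\mathbb R$, $S(\alpha):=\inf\{s\ge0:\partial h(z)\subseteq \bar B(0,s)+N_{\operatorname{dom}h}(z)\text{ whenever }\phi_{\bar c}(z)\le\alpha\}<\infty$, where $N_X(z)$ is the normal cone of $X$ at $z$. **Parameters.** Let $\theta\in(0,1]$; $\tau_\theta=\frac{\theta}{16-17\theta}$ if $\theta\le\frac{16}{19}$ and $\tau_\theta=\frac12$ otherwise; $\lambda=\tau_\theta/m$; $\sigma_\theta$ the unique positive root of $\big(\frac34+\frac{2(1-\theta)(3\tau_\theta+1)}{\theta\tau_\theta}\big)\sigma^2+\frac{8-7\theta}{2\theta}\sigma-\frac18=0$; $\kappa_\theta=1+\frac{16(1-\theta)}{\theta\tau_\theta}$. Let $z_0\in\operatorname{dom}h$, $c>2\bar c$, $\hat\rho>0$, $L_c=L+c\|A\|^2$, $\sigma=\min\{(\lambda L_c+1)^{-1/2},\sigma_\theta\}$. **ACG method** with input $(\psi_s,\psi_n)$, $(M_s,\mu)$, $x_0$. Put $y_0=x_0$, $A_0=0$, $\Gamma_0\equiv0$, and for $j\ge0$, with $a_j=A_{j+1}-A_j$: $A_{j+1}=A_j+\frac{\mu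 A_j+1+\sqrt{(\mu A_j+1)^2+4M_s(\mu A_j+1)A_j}}{2M_s}$, $\tilde x_j=\frac{A_jx_j+a_jy_j}{A_{j+1}}$, $\Gamma_{j+1}=\frac{A_j\Gamma_j+a_j\left[\psi_s(\tilde x_j)+\langle\nabla\psi_s(\tilde x_j),\cdot-\tilde x_j\rangle\right]}{A_{j+1}}$, $y_{j+1}=\operatorname{argmin}\{\Gamma_{j+1}+\psi_n+\frac1{2A_{j+1}}\|\cdot-y_0\|^2\}$, $x_{j+1}=\frac{A_jx_j+a_jy_{j+1}}{A_{j+1}}$, $u_{j+1}=\frac{y_0-y_{j+1}}{A_{j+1}}$, $\eta_{j+1}=(\psi_s+\psi_n)(x_{j+1})-\Gamma_{j+1}(y_{j+1})-\psi_n(y_{j+1})-\langle u_{j+1},x_{j+1}-y_{j+1}\rangle$. **Static $\theta$-IPAAL method.** Put $p_0=0$. For $k=1,2,\dots$, with $g_k=f+(1-\theta)\langle p_{k-1},A\cdot-b\rangle+\frac c2\|A\cdot-b\|^2$: (1) run the ACG method with $\psi_s=\lambda g_k+\frac{\tau_\theta}2\|\cdot-z_{k-1}\|^2$, $\psi_n=\lambda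 h+\frac{1-\tau_\theta}2\|\cdot-z_{k-1}\|^2$, $(M_s,\mu)=(\lambda L_c+\tau_\theta,1-\tau_\theta)$, $x_0=z_{k-1}$, and let $(z_k,v_k,\varepsilon_k)$ be an iterate $(x_j,u_j,\eta_j)$, $j\ge1$, with $\|v_k\|^2+2\varepsilon_k\le\sigma^2\|v_k+z_{k-1}-z_k\|^2$; (2) with $g_\lambda=\lambda g_k+\frac12\|\cdot-z_{k-1}\|^2-\langle v_k,\cdot\rangle$, let $\hat z_k$ be the minimizer of $\langle\nabla g_\lambda(z_k),\cdot-z_k\rangle+\frac{\lambda L_c+1}2\|\cdot-z_k\|^2+\lambda h$, and put $\hat v_k=\frac1\lambda[(v_k+z_{k-1}-z_k)+(\lambda L_c+1)(z_k-\hat z_k)]+\nabla g_k(\hat z_k)-\nabla g_k(z_k)$ and $\hat p_k=(1-\theta)p_{k-1}+c(A\hat z_k-b)$; (3) if $\|\hat v_k\|\le\hat\rho$, stop with output $(\hat z,\hat v,\hat p)=(\hat z_k,\hat v_k,\hat p_k)$; otherwise put $p_k=(1-\theta)p_{k-1}+c(Az_k-b)$ and continue. **Constants.** Let $R_0=\inf\{\lambda[\phi(z)-\phi^*_{\bar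 c}]+\|z-z_0\|^2:z\in\mathcal F\}$, let $\sigma^+(A)$ be the smallest positive eigenvalue of $(A^*A)^{1/2}$, let $$\alpha=\frac{\kappa_\theta R_0}{\lambda}+\max\{\phi_{\bar c}(z_0),\phi_{\bar c}(\bar z)\},$$ and $$N_0=\frac1{\sigma^+(A)}\left(1+\frac{\max\{\sqrt{3\kappa_\theta R_0},D(\alpha)\}}{\operatorname{dist}_{\partial(\operatorname{dom}h)}(\bar z)}\right)\left[\|\nabla f(z_0)\|+LD(\alpha)+S(\alpha)+\Big(L+\frac{14}{\lambda\sqrt\theta}\Big)\sqrt{3\kappa_\theta R_0}\right]$$ (the distance to the empty set being $+\infty$). The constant $N_0$ does not depend on $c$ or $\hat\rho$. **Theorem.** Under (A1)–(A4) and (B1)–(B3), the output $(\hat z,\hat v,\hat p)$ of the static $\theta$-IPAAL method satisfies $$\hat v\in\nabla f(\hat z)+\partial h(\hat z)+A^*\hat p,\qquad\|\hat v\|\le\hat\rho,\qquad\|A\hat z-b\|\le\frac{2N_0}{c}.$$ -/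

import Mathlib

open Set
open scoped Pointwise InnerProductSpace

noncomputable section

namespace IPAAL

section General

variable {E : Type*} [NormedAddCommGroup E] [InnerProductSpace ℝ E] [CompleteSpace E]

/-- The effective domain of an extended-real-valued function. -/
def dom (h : E → EReal) : Set E := {z | h z < ⊤}

/-- `h : E → (-∞, ∞]` is a proper closed convex function:
it never takes the value `-∞`, it is finite somewhere, it is convex and lower semicontinuous. -/
structure IsClosedProperConvex (h : E → EReal) : Prop where
  ne_bot : ∀ z, h z ≠ ⊥
  dom_nonempty : (dom h).Nonempty
  convex : ∀ (x y : E) (s t : ℝ), 0 < s → 0 < t → s + t = 1 →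
    h (s • x + t • y) ≤ (s : EReal) * h x + (t : EReal) * h y
  lsc : LowerSemicontinuous h

/-- The subdifferential `∂h(z)`. It is empty at points outside the domain of a proper `h`. -/
def subdiff (h : E → EReal) (z : E) : Set E :=
  {u | ∀ w : E, h z + ((⟪u, w - z⟫_ℝ : ℝ) : EReal) ≤ h w}

/-- The normal cone of a convex set `X` at a point `z`. -/
def normalCone (X : Set E) (z : E) : Set E := {ξ | ∀ x ∈ X, ⟪ξ, x - z⟫_ℝ ≤ 0}

/-- The sublevel set `{z : φ z ≤ α}`. -/
def sublevel (φ : E → EReal) (α : ℝ) : Set E := {z | φ z ≤ (α : EReal)}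

/-- The affine approximation at `x₀` of a function `ψ` that is differentiable on `X`:
`w ↦ ψ x₀ + ⟪∇ψ x₀, w - x₀⟫`. The gradient is taken relative to `X`; if `X` is convex with
nonempty interior it is unique, and it is the usual gradient wherever `ψ` is differentiable in the
full space. -/
def linApprox (ψ : E → ℝ) (X : Set E) (x₀ w : E) : ℝ :=
  ψ x₀ + ⟪gradientWithin ψ X x₀, w - x₀⟫_ℝ

/-- The iterates of the accelerated composite gradient (ACG) method with inputs `(ψs, ψn)`,
`(Ms, μ)` and starting point `x₀`. Here `a` is the scalar sequence (usually called `A_j`),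
`x`, `y` are the iterates, `Γ` the affine minorants of `ψs`, and `u`, `η` the residuals. -/
structure IsACGRun (ψs : E → ℝ) (ψn : E → EReal) (Ms μ : ℝ) (x₀ : E)
    (a : ℕ → ℝ) (x y : ℕ → E) (Γ : ℕ → E → ℝ) (u : ℕ → E) (η : ℕ → ℝ) : Prop where
  x_zero : x 0 = x₀
  y_zero : y 0 = x₀
  a_zero : a 0 = 0
  Γ_zero : ∀ w, Γ 0 w = 0
  a_succ : ∀ j, a (j + 1) = a j +
    (μ * a j + 1 + √((μ * a j + 1) ^ 2 + 4 * Ms * (μ * a j + 1) * a j)) / (2 * Ms)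
  Γ_succ : ∀ j w, Γ (j + 1) w = (a j / a (j + 1)) * Γ j w + ((a (j + 1) - a j) / a (j + 1)) *
    linApprox ψs (dom ψn)
      ((a j / a (j + 1)) • x j + ((a (j + 1) - a j) / a (j + 1)) • y j) w
  y_succ : ∀ j, IsMinOn
    (fun w => ((Γ (j + 1) w : ℝ) : EReal) + ψn w
      + ((1 / (2 * a (j + 1)) * ‖w - y 0‖ ^ 2 : ℝ) : EReal))
    univ (y (j + 1))
  x_succ : ∀ j, x (j + 1) =
    (a j / a (j + 1)) • x j + ((a (j + 1) - a j) / a (j + 1)) • y (j + 1)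
  u_succ : ∀ j, u (j + 1) = (1 / a (j + 1)) • (y 0 - y (j + 1))
  η_succ : ∀ j, η (j + 1) = (ψs (x (j + 1)) + (ψn (x (j + 1))).toReal)
    - Γ (j + 1) (y (j + 1)) - (ψn (y (j + 1))).toReal
    - ⟪u (j + 1), x (j + 1) - y (j + 1)⟫_ℝ

/-- `(zh, vh)` is the pair computed by the refinement procedure for the composite function
`g + h`, where `∇g` is `M`-Lipschitz on `dom h`, from the input `(lam, zm, z, v)`:
with `g_lam = lam g + ‖· - zm‖²/2 - ⟪v, ·⟫`, the point `zh` minimizes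
`⟪∇g_lam z, · - z⟫ + (lam M + 1)/2 ‖· - z‖² + lam h`. -/
structure IsRefinement (g : E → ℝ) (h : E → EReal) (M lam : ℝ) (zm z v zh vh : E) : Prop where
  argmin : IsMinOn
    (fun w => ((⟪gradientWithin
          (fun x => lam * g x + 1 / 2 * ‖x - zm‖ ^ 2 - ⟪v, x⟫_ℝ) (dom h) z, w - z⟫_ℝ
        + (lam * M + 1) / 2 * ‖w - z‖ ^ 2 : ℝ) : EReal) + (lam : EReal) * h w)
    univ zh
  residual : vh = (1 / lam) • ((v + zm - z) + (lam * M + 1) • (z - zh))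
    + gradientWithin g (dom h) zh - gradientWithin g (dom h) z

end General

/-- The parameter `τ_θ`, for `θ ∈ (0, 1]`. -/
def tau (θ : ℝ) : ℝ := if θ ≤ 16 / 19 then θ / (16 - 17 * θ) else 1 / 2

/-- The quadratic polynomial whose unique positive root is `σ_θ`. -/
def sigmaPoly (θ s : ℝ) : ℝ :=
  (3 / 4 + 2 * (1 - θ) * (3 * tau θ + 1) / (θ * tau θ)) * s ^ 2
    + ((8 - 7 * θ) / (2 * θ)) * s - 1 / 8

/-- The parameter `σ_θ`: the only positive root of `sigmaPoly θ`, by the quadratic formula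
(see `sigmaTheta_spec`). -/
def sigmaTheta (θ : ℝ) : ℝ :=
  (-((8 - 7 * θ) / (2 * θ)) + √(((8 - 7 * θ) / (2 * θ)) ^ 2
      + (3 / 4 + 2 * (1 - θ) * (3 * tau θ + 1) / (θ * tau θ)) / 2)) /
    (2 * (3 / 4 + 2 * (1 - θ) * (3 * tau θ + 1) / (θ * tau θ)))

theorem tau_pos {θ : ℝ} (h0 : 0 < θ) : 0 < tau θ := by
  unfold tau
  split_ifs with h
  · exact div_pos h0 (by linarith)
  · norm_num

theorem sigmaTheta_spec {θ : ℝ} (h0 : 0 < θ) (h1 : θ ≤ 1) (s : ℝ) :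
    (0 < s ∧ sigmaPoly θ s = 0) ↔ s = sigmaTheta θ := by
  have hτ := tau_pos h0
  unfold sigmaPoly sigmaTheta
  have ha : 0 < 3 / 4 + 2 * (1 - θ) * (3 * tau θ + 1) / (θ * tau θ) := by
    have : 0 ≤ 2 * (1 - θ) * (3 * tau θ + 1) / (θ * tau θ) :=
      div_nonneg (mul_nonneg (by linarith) (by linarith)) (by positivity)
    linarith
  have hb : 0 < (8 - 7 * θ) / (2 * θ) := div_pos (by linarith) (by linarith)
  generalize 3 / 4 + 2 * (1 - θ) * (3 * tau θ + 1) / (θ * tau θ) = a at ha ⊢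
  generalize (8 - 7 * θ) / (2 * θ) = b at hb ⊢
  have hr : √(b ^ 2 + a / 2) ^ 2 = b ^ 2 + a / 2 := Real.sq_sqrt (by positivity)
  have hrb : b < √(b ^ 2 + a / 2) := Real.lt_sqrt_of_sq_lt (by linarith)
  generalize √(b ^ 2 + a / 2) = r at hr hrb ⊢
  rw [eq_div_iff (by positivity)]
  constructor
  · rintro ⟨hs, h⟩
    have h2 : (2 * a * s + b - r) * (2 * a * s + b + r) = 0 := by nlinarith
    have h3 : 0 < 2 * a * s + b + r := by
      have : 0 < 2 * a * s := by positivity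
      linarith
    rcases mul_eq_zero.1 h2 with h4 | h4 <;> linarith
  · intro h
    have hs : 0 < s := by
      by_contra hn
      have : a * s ≤ 0 := mul_nonpos_of_nonneg_of_nonpos ha.le (not_lt.1 hn)
      linarith
    refine ⟨hs, ?_⟩
    have h2 : a * (a * s ^ 2 + b * s - 1 / 8) = 0 := by
      have h3 : r = 2 * a * s + b := by linarith
      rw [h3] at hr
      nlinarith
    rcases mul_eq_zero.1 h2 with h4 | h4
    · linarith
    · exact h4

/-- The constant `κ_θ`. -/
def kappa (θ : ℝ) : ℝ := 1 + 16 * (1 - θ) / (θ * tau θ)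

/-- The data of the problem `min {f z + h z : A z = b}` in Euclidean spaces. -/
structure Problem (n l : ℕ) where
  f : EuclideanSpace ℝ (Fin n) → ℝ
  h : EuclideanSpace ℝ (Fin n) → EReal
  A : EuclideanSpace ℝ (Fin n) →L[ℝ] EuclideanSpace ℝ (Fin l)
  b : EuclideanSpace ℝ (Fin l)

namespace Problem

variable {n l : ℕ} (P : Problem n l)

/-- The gradient of `f` at a point of `dom h`. -/
def gradf (z : EuclideanSpace ℝ (Fin n)) : EuclideanSpace ℝ (Fin n) :=
  gradientWithin P.f (dom P.h) z

/-- The feasible set `{z ∈ dom h : A z = b}`. -/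
def feasible : Set (EuclideanSpace ℝ (Fin n)) := {z | z ∈ dom P.h ∧ P.A z = P.b}

/-- The penalized objective `φ_c = f + h + (c/2) ‖A · - b‖²`. -/
def phi (c : ℝ) (z : EuclideanSpace ℝ (Fin n)) : EReal :=
  (P.f z : EReal) + P.h z + ((c / 2 * ‖P.A z - P.b‖ ^ 2 : ℝ) : EReal)

/-- `φ*_c`, the infimum of `φ_c` over the whole space. -/
def phiStar (c : ℝ) : EReal := ⨅ z, P.phi c z

/-- The basic assumptions on the problem, with constants `L`, `m` and `cbar`. -/
structure BasicAssumptions (L m cbar : ℝ) : Prop where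
  A_ne_zero : P.A ≠ 0
  feasible_nonempty : P.feasible.Nonempty
  h_closed_proper_convex : IsClosedProperConvex P.h
  f_diff : DifferentiableOn ℝ P.f (dom P.h)
  m_pos : 0 < m
  m_le_L : m ≤ L
  grad_lipschitz : ∀ z ∈ dom P.h, ∀ w ∈ dom P.h, ‖P.gradf w - P.gradf z‖ ≤ L * ‖w - z‖
  lower_curvature : ∀ z ∈ dom P.h, ∀ w ∈ dom P.h,
    -(m / 2) * ‖w - z‖ ^ 2 ≤ P.f w - (P.f z + ⟪P.gradf z, w - z⟫_ℝ)
  cbar_nonneg : 0 ≤ cbar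
  phiStar_gt_bot : ⊥ < P.phiStar cbar

/-- `D(α)`: the supremum of `‖x - x'‖` over `x, x'` in the `α`-sublevel set of `φ_cbar`. -/
def D (cbar α : ℝ) : ℝ := Metric.diam (sublevel (P.phi cbar) α)

/-- The set of all `s ≥ 0` with `∂h(z) ⊆ closedBall 0 s + N_{dom h}(z)` for every `z` in the
`α`-sublevel set of `φ_cbar`. -/
def subdiffBounds (cbar α : ℝ) : Set ℝ :=
  {s | 0 ≤ s ∧ ∀ z ∈ sublevel (P.phi cbar) α,
    subdiff P.h z ⊆ Metric.closedBall 0 s + normalCone (dom P.h) z}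

/-- `S(α)`, the infimum of `subdiffBounds`. -/
def S (cbar α : ℝ) : ℝ := sInf (P.subdiffBounds cbar α)

/-- `R₀ = inf {lam (f z + h z - φ*_cbar) + ‖z - z₀‖² : z feasible}`. Under the basic assumptions
all the values involved are finite, and the set is nonempty and bounded below. -/
def R0 (lam cbar : ℝ) (z₀ : EuclideanSpace ℝ (Fin n)) : ℝ :=
  sInf ((fun z => lam * (P.f z + (P.h z).toReal - (P.phiStar cbar).toReal) + ‖z - z₀‖ ^ 2) ''
    P.feasible)

/-- `σ⁺(A)`: the smallest positive eigenvalue of `(A* A)^{1/2}`, that is, the smallest `s > 0`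
such that `s²` is an eigenvalue of `A* A`. -/
def sigmaPlus : ℝ :=
  sInf {s : ℝ | 0 < s ∧ Module.End.HasEigenvalue
    ((ContinuousLinearMap.adjoint P.A ∘L P.A :
      EuclideanSpace ℝ (Fin n) →L[ℝ] EuclideanSpace ℝ (Fin n)) :
      Module.End ℝ (EuclideanSpace ℝ (Fin n))) (s ^ 2)}

/-- The level `α = κ_θ R₀ / lam + max {φ_cbar(z₀), φ_cbar(zbar)}`. -/
def level (θ lam cbar : ℝ) (zbar z₀ : EuclideanSpace ℝ (Fin n)) : ℝ :=
  kappa θ * P.R0 lam cbar z₀ / lam + max (P.phi cbar z₀).toReal (P.phi cbar zbar).toReal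

/-- The constant `N₀`; it does not involve the penalty parameter. If `dom h` is the whole space
then its boundary is empty, the distance to it is infinite, and the fraction is zero; the
conventions of `Metric.infDist` and of division by zero give the same value. -/
def N0 (L θ lam cbar : ℝ) (zbar z₀ : EuclideanSpace ℝ (Fin n)) : ℝ :=
  (1 / P.sigmaPlus) *
    (1 + max (√(3 * kappa θ * P.R0 lam cbar z₀)) (P.D cbar (P.level θ lam cbar zbar z₀)) /
      Metric.infDist zbar (frontier (dom P.h))) *
    (‖P.gradf z₀‖ + L * P.D cbar (P.level θ lam cbar zbar z₀)
      + P.S cbar (P.level θ lam cbar zbar z₀)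
      + (L + 14 / (lam * √θ)) * √(3 * kappa θ * P.R0 lam cbar z₀))

/-- `L_c = L + c ‖A‖²`. -/
def Lc (L c : ℝ) : ℝ := L + c * ‖P.A‖ ^ 2

/-- The tolerance `σ = min {1 / √(lam L_c + 1), σ_θ}`. -/
def sigma (L θ lam c : ℝ) : ℝ := min (1 / √(lam * P.Lc L c + 1)) (sigmaTheta θ)

/-- The smooth part of the `θ`-augmented Lagrangian,
`g = f + (1 - θ) ⟪p, A · - b⟫ + (c/2) ‖A · - b‖²`. -/
def smoothAL (θ c : ℝ) (p : EuclideanSpace ℝ (Fin l)) (z : EuclideanSpace ℝ (Fin n)) : ℝ :=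
  P.f z + (1 - θ) * ⟪p, P.A z - P.b⟫_ℝ + c / 2 * ‖P.A z - P.b‖ ^ 2

/-- Step 1 of the static `θ`-IPAAL method: the triple `(z, v, ε)` is an iterate, with index at
least one, of the ACG method applied to
`ψs = lam g + (τ_θ/2) ‖· - zm‖²`, `ψn = lam h + ((1 - τ_θ)/2) ‖· - zm‖²`,
`(Ms, μ) = (lam L_c + τ_θ, 1 - τ_θ)`, `x₀ = zm`, and it passes the stopping test
`‖v‖² + 2 ε ≤ σ² ‖v + zm - z‖²`. The inclusion
`v ∈ ∂_ε (lam (g + h) + ‖· - zm‖²/2) (z)` is a property of all ACG iterates, not tested. -/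
def IsStep1 (L θ lam c : ℝ) (p : EuclideanSpace ℝ (Fin l))
    (zm z v : EuclideanSpace ℝ (Fin n)) (ε : ℝ) : Prop :=
  (∃ (a : ℕ → ℝ) (x y : ℕ → EuclideanSpace ℝ (Fin n))
      (Γ : ℕ → EuclideanSpace ℝ (Fin n) → ℝ) (u : ℕ → EuclideanSpace ℝ (Fin n)) (η : ℕ → ℝ),
    IsACGRun (fun w => lam * P.smoothAL θ c p w + tau θ / 2 * ‖w - zm‖ ^ 2)
      (fun w => (lam : EReal) * P.h w
        + (((1 - tau θ) / 2 * ‖w - zm‖ ^ 2 : ℝ) : EReal))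
      (lam * P.Lc L c + tau θ) (1 - tau θ) zm a x y Γ u η ∧
    ∃ j, 1 ≤ j ∧ z = x j ∧ v = u j ∧ ε = η j) ∧
  ‖v‖ ^ 2 + 2 * ε ≤ P.sigma L θ lam c ^ 2 * ‖v + zm - z‖ ^ 2

/-- `(zhat, vhat, phat)` is the output of the static `θ`-IPAAL method with initial point `z₀`,
penalty parameter `c` and tolerance `ρ`, where `lam = τ_θ / m`: there are outer iterations
`1, …, K + 1` that follow the steps of the method, the last one being the first with `‖v̂_k‖ ≤ ρ`. -/
def IsStaticOutput (L m θ c ρ : ℝ) (z₀ zhat vhat : EuclideanSpace ℝ (Fin n))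
    (phat : EuclideanSpace ℝ (Fin l)) : Prop :=
  ∃ (K : ℕ) (z v zh vh : ℕ → EuclideanSpace ℝ (Fin n)) (p ph : ℕ → EuclideanSpace ℝ (Fin l))
    (ε : ℕ → ℝ),
    z 0 = z₀ ∧ p 0 = 0 ∧
    (∀ k < K + 1,
      P.IsStep1 L θ (tau θ / m) c (p k) (z k) (z (k + 1)) (v (k + 1)) (ε (k + 1)) ∧
      IsRefinement (P.smoothAL θ c (p k)) P.h (P.Lc L c) (tau θ / m)
        (z k) (z (k + 1)) (v (k + 1)) (zh (k + 1)) (vh (k + 1)) ∧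
      ph (k + 1) = (1 - θ) • p k + c • (P.A (zh (k + 1)) - P.b)) ∧
    (∀ k < K, ρ < ‖vh (k + 1)‖ ∧
      p (k + 1) = (1 - θ) • p k + c • (P.A (z (k + 1)) - P.b)) ∧
    ‖vh (K + 1)‖ ≤ ρ ∧
    zhat = zh (K + 1) ∧ vhat = vh (K + 1) ∧ phat = ph (K + 1)

end Problem

end IPAAL

end

open Set
open scoped Pointwise InnerProductSpace

noncomputable section

namespace IPAAL

/-! ### Inexact proximal steps on the `θ`-augmented Lagrangian -/

section InexactStep

variable {E F : Type*} [NormedAddCommGroup E] [InnerProductSpace ℝ E]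
  [NormedAddCommGroup F] [InnerProductSpace ℝ F]

/-! The inclusion is the optimality condition of the refinement step, and the residual bound is the
stopping test. For feasibility, `c (A ẑ_k - b) = p̂_k - (1 - θ) p_{k-1}`, so it suffices to bound
both multipliers by `N₀`, uniformly in `c` and in the number of iterations.

Bounding `p̂_k`: either `‖p̂_k‖ ≤ (1 - θ) ‖p_{k-1}‖`, or Cauchy–Schwarz in the multiplier update
gives `⟪p̂_k, A ẑ_k - b⟫ ≥ 0`. In the second case write the subgradient of `h` at `ẑ_k` as a bounded
vector plus a normal vector. Pairing with `ẑ_k - z̄`, the multiplier term has a favourable sign and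
is dropped; since `z̄` is interior, this bounds the normal vector. Hence `A* p̂_k` is bounded, and
so is `p̂_k`, because it lies in the range of `A`, where `σ⁺(A) ‖q‖ ≤ ‖A* q‖`
(`sigmaPlus_mul_norm_multiplier_le`).

From `p̂_k` to `p_k`: their difference `c A (z_k - ẑ_k)` costs at most `‖r_k‖ / λ` after
multiplication by `σ⁺(A)`, with `r_k = v_k + z_{k-1} - z_k`; the condition `σ ≤ (λ L_c + 1)^{-1/2}`
is what cancels `c`. These errors accumulate only in a sum discounted by `1 - θ`, so square
summability of `r_k` controls them (`discounted_sum_bound`).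

Two facts remain: `∑ ‖r_k‖² ≤ 3 κ_θ R₀`, and `ẑ_k` stays in a fixed sublevel set of `φ_c̄`. Both
come from a potential (`inexact_run_estimate`): the augmented Lagrangian decreases in each proximal
step but increases in the multiplier update, and the increase is absorbed by `‖p_k - p_{k-1}‖²` and
`‖z_k - z_{k-1}‖²`, through the monotonicity inequality for two consecutive steps (`two_steps`). The
estimate controls only the last iterate of a run. It nevertheless applies to `ẑ_k`, since `ẑ_k` is
itself an inexact solution of the same subproblem with relative error `16/15 σ`
(`refinement_inexactStep`) and may replace `z_k` at the end of the run. -/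

theorem norm_sq_convex_comb (x y : E) (t : ℝ) :
    ‖(1 - t) • x + t • y‖ ^ 2
      = (1 - t) * ‖x‖ ^ 2 + t * ‖y‖ ^ 2 - t * (1 - t) * ‖y - x‖ ^ 2 := by
  rw [norm_add_sq_real, norm_sub_sq_real, norm_smul, norm_smul, mul_pow, mul_pow,
    inner_smul_left, inner_smul_right, real_inner_comm x y]
  simp only [Real.norm_eq_abs, sq_abs, conj_trivial]
  ring

/-- The `θ`-augmented Lagrangian of `min {φ z : A z = b}`. -/
def augLag (φ : E → ℝ) (A : E →L[ℝ] F) (b : F) (θ c : ℝ) (p : F) (z : E) : ℝ :=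
  φ z + (1 - θ) * ⟪p, A z - b⟫_ℝ + c / 2 * ‖A z - b‖ ^ 2

/-- `(z, v, ε)` is an inexact solution, with relative error `s`, of the proximal subproblem
`min {lam * augLag p + ‖· - zm‖² / 2}` over `C`. -/
structure InexactStep (φ : E → ℝ) (C : Set E) (A : E →L[ℝ] F) (b : F) (lam θ c s : ℝ)
    (p : F) (zm z v : E) (ε : ℝ) : Prop where
  mem : z ∈ C
  subgrad : ∀ w ∈ C, lam * augLag φ A b θ c p z + 1 / 2 * ‖z - zm‖ ^ 2 + ⟪v, w - z⟫_ℝ - ε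
    ≤ lam * augLag φ A b θ c p w + 1 / 2 * ‖w - zm‖ ^ 2
  error : ‖v‖ ^ 2 + 2 * ε ≤ s ^ 2 * ‖v + zm - z‖ ^ 2

/-- `φ` is convex on `C` up to the quadratic `m / 2 * ‖·‖²`. -/
def WeaklyConvexOn (C : Set E) (φ : E → ℝ) (m : ℝ) : Prop :=
  ∀ z ∈ C, ∀ w ∈ C, ∀ t : ℝ, 0 < t → t < 1 →
    φ ((1 - t) • z + t • w) ≤ (1 - t) * φ z + t * φ w + m / 2 * (t * (1 - t)) * ‖w - z‖ ^ 2

variable {φ : E → ℝ} {C : Set E} {A : E →L[ℝ] F} {b : F} {lam θ c s : ℝ}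

theorem augLag_convex_comb_le {m : ℝ} (hφ : WeaklyConvexOn C φ m) (p : F) {z w : E}
    (hz : z ∈ C) (hw : w ∈ C) {t : ℝ} (ht0 : 0 < t) (ht1 : t < 1) :
    augLag φ A b θ c p ((1 - t) • z + t • w)
      ≤ (1 - t) * augLag φ A b θ c p z + t * augLag φ A b θ c p w
        + t * (1 - t) / 2 * (m * ‖w - z‖ ^ 2 - c * ‖A (w - z)‖ ^ 2) := by
  have h := hφ z hz w hw t ht0 ht1
  have hA : A ((1 - t) • z + t • w) - b = (1 - t) • (A z - b) + t • (A w - b) := by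
    simp only [map_add, map_smul]
    module
  have hd : (A w - b) - (A z - b) = A (w - z) := by simp
  unfold augLag
  rw [hA, norm_sq_convex_comb, hd, inner_add_right, inner_smul_right, inner_smul_right]
  linarith

namespace InexactStep

variable {p : F} {zm z v : E} {ε : ℝ}

theorem eps_nonneg (h : InexactStep φ C A b lam θ c s p zm z v ε) : 0 ≤ ε := by
  have := h.subgrad z h.mem
  simp only [sub_self, inner_zero_right] at this
  linarith

theorem norm_residual_le (h : InexactStep φ C A b lam θ c s p zm z v ε) (hs : 0 ≤ s) :
    ‖v‖ ≤ s * ‖v + zm - z‖ := by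
  have h1 := h.error
  have h2 := h.eps_nonneg
  refine abs_le_of_sq_le_sq' ?_ (by positivity) |>.2
  rw [mul_pow]
  linarith

theorem norm_step_le (h : InexactStep φ C A b lam θ c s p zm z v ε) (hs : 0 ≤ s) :
    ‖z - zm‖ ≤ (1 + s) * ‖v + zm - z‖ := by
  have h1 := h.norm_residual_le hs
  have h2 : z - zm = v - (v + zm - z) := by abel
  calc ‖z - zm‖ = ‖v - (v + zm - z)‖ := by rw [← h2]
    _ ≤ ‖v‖ + ‖v + zm - z‖ := norm_sub_le _ _
    _ ≤ _ := by linarith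

theorem mono {s' : ℝ} (h : InexactStep φ C A b lam θ c s p zm z v ε) (hs : 0 ≤ s) (hs' : s ≤ s') :
    InexactStep φ C A b lam θ c s' p zm z v ε :=
  ⟨h.mem, h.subgrad, h.error.trans (by gcongr)⟩

/-- Completing the square in the subgradient inequality. -/
theorem subgrad_sq (h : InexactStep φ C A b lam θ c s p zm z v ε) {w : E} (hw : w ∈ C) :
    lam * augLag φ A b θ c p z + 1 / 2 * ‖v + zm - z‖ ^ 2 - ε
      ≤ lam * augLag φ A b θ c p w + 1 / 2 * ‖w - zm - v‖ ^ 2 := by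
  have h1 := h.subgrad w hw
  have e1 : v + zm - z = v - (z - zm) := by abel
  have e2 : w - z = (w - zm) - (z - zm) := by abel
  rw [e2, inner_sub_right] at h1
  rw [e1, norm_sub_sq_real v, norm_sub_sq_real (w - zm), real_inner_comm v (w - zm)]
  linarith

theorem descent (h : InexactStep φ C A b lam θ c s p zm z v ε) (hzm : zm ∈ C) :
    lam * augLag φ A b θ c p z + (1 - s ^ 2) / 2 * ‖v + zm - z‖ ^ 2
      ≤ lam * augLag φ A b θ c p zm := by
  have h1 := h.subgrad_sq hzm
  have h2 := h.error
  simp only [sub_self, zero_sub, norm_neg] at h1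
  linarith

/-- The first step compared with a feasible point. -/
theorem le_of_feasible (h : InexactStep φ C A b lam θ c s 0 zm z v ε) {w : E} (hw : w ∈ C)
    (hwb : A w = b) :
    lam * (φ z + c / 2 * ‖A z - b‖ ^ 2) + (1 - 2 * s ^ 2) / 2 * ‖v + zm - z‖ ^ 2
      ≤ lam * φ w + ‖w - zm‖ ^ 2 := by
  have h1 := h.subgrad_sq hw
  have h2 := h.error
  have h3 := h.eps_nonneg
  have h4 : ‖w - zm - v‖ ^ 2 ≤ 2 * (‖w - zm‖ ^ 2 + ‖v‖ ^ 2) := by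
    have := parallelogram_law_with_norm ℝ (w - zm) v
    nlinarith [sq_nonneg ‖w - zm + v‖]
  simp only [augLag, inner_zero_left, mul_zero, add_zero, hwb, sub_self, norm_zero,
    ne_eq, OfNat.ofNat_ne_zero, not_false_eq_true, zero_pow] at h1
  linarith

/-- The `ε`-subgradient inequality, strengthened by the strong convexity of the subproblem. -/
theorem quadratic_growth {m : ℝ} (hφ : WeaklyConvexOn C φ m) (hlam : 0 ≤ lam)
    (hC : Convex ℝ C)
    (h : InexactStep φ C A b lam θ c s p zm z v ε) {w : E} (hw : w ∈ C)
    {t : ℝ} (ht0 : 0 < t) (ht1 : t < 1) :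
    lam * augLag φ A b θ c p z + 1 / 2 * ‖z - zm‖ ^ 2 + ⟪v, w - z⟫_ℝ - ε / t
        + (1 - t) / 2 * (lam * c * ‖A (w - z)‖ ^ 2 + (1 - lam * m) * ‖w - z‖ ^ 2)
      ≤ lam * augLag φ A b θ c p w + 1 / 2 * ‖w - zm‖ ^ 2 := by
  -- The inequality is tested at an intermediate point of the segment and divided by `t`, which
  -- costs `ε / t` and leaves the factor `1 - t` on the curvature. A positive `ε` rules out the
  -- limit `t → 0`; `t = lam * m` is taken later.
  have hx : (1 - t) • z + t • w ∈ C := hC h.mem hw (by linarith) ht0.le (by ring)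
  have h1 := h.subgrad _ hx
  have h2 := mul_le_mul_of_nonneg_left
    (augLag_convex_comb_le (A := A) (b := b) (θ := θ) (c := c) hφ p h.mem hw ht0 ht1) hlam
  have e1 : (1 - t) • z + t • w - z = t • (w - z) := by module
  have e2 : (1 - t) • z + t • w - zm = (1 - t) • (z - zm) + t • (w - zm) := by module
  have e3 : (w - zm) - (z - zm) = w - z := by abel
  rw [e1, e2, norm_sq_convex_comb, e3, inner_smul_right] at h1
  have e4 : t * (ε / t) = ε := by field_simp
  refine le_of_mul_le_mul_left ?_ ht0
  nlinarith

/-- Monotonicity of the subproblem operator along two consecutive steps. -/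
theorem two_steps {m : ℝ} (hφ : WeaklyConvexOn C φ m) (hlam : 0 ≤ lam) (hC : Convex ℝ C)
    {p₀ p₁ : F} {z₀ z₁ z₂ v₁ v₂ : E} {ε₁ ε₂ : ℝ}
    (h1 : InexactStep φ C A b lam θ c s p₀ z₀ z₁ v₁ ε₁)
    (h2 : InexactStep φ C A b lam θ c s p₁ z₁ z₂ v₂ ε₂) {t : ℝ} (ht0 : 0 < t) (ht1 : t < 1) :
    lam * (1 - θ) * ⟪p₁ - p₀, A (z₂ - z₁)⟫_ℝ
        + (1 - t) * (lam * c * ‖A (z₂ - z₁)‖ ^ 2 + (1 - lam * m) * ‖z₂ - z₁‖ ^ 2)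
      ≤ ⟪v₂ - v₁, z₂ - z₁⟫_ℝ + ⟪z₁ - z₀, z₂ - z₁⟫_ℝ + (ε₁ + ε₂) / t := by
  have g1 := h1.quadratic_growth hφ hlam hC h2.mem ht0 ht1
  have g2 := h2.quadratic_growth hφ hlam hC h1.mem ht0 ht1
  have e1 : z₁ - z₂ = -(z₂ - z₁) := by abel
  have e2 : z₂ - z₀ = (z₁ - z₀) + (z₂ - z₁) := by abel
  rw [e1, map_neg, norm_neg, norm_neg, inner_neg_right] at g2
  rw [e2, norm_add_sq_real] at g1
  simp only [sub_self, norm_zero] at g2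
  have e4 : A z₂ - b = (A z₁ - b) + A (z₂ - z₁) := by simp
  have e3 : (ε₁ + ε₂) / t = ε₁ / t + ε₂ / t := by ring
  have e5 : augLag φ A b θ c p₀ z₂ - augLag φ A b θ c p₀ z₁ - augLag φ A b θ c p₁ z₂
      + augLag φ A b θ c p₁ z₁ = - (1 - θ) * ⟪p₁ - p₀, A (z₂ - z₁)⟫_ℝ := by
    simp only [augLag, inner_sub_left, map_sub, inner_sub_right]
    ring
  have e6 : lam * (1 - θ) * ⟪p₁ - p₀, A (z₂ - z₁)⟫_ℝ = - lam * (augLag φ A b θ c p₀ z₂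
      - augLag φ A b θ c p₀ z₁ - augLag φ A b θ c p₁ z₂ + augLag φ A b θ c p₁ z₁) := by
    rw [e5]; ring
  rw [e3, e6, inner_sub_left]
  linarith

end InexactStep

/-! ### Multiplier dynamics and the potential -/

theorem multiplier_contraction {p₀ p₁ p₂ : F} {z₁ z₂ : E} (hc : 0 < c) (hlam : 0 ≤ lam)
    (hp1 : p₁ = (1 - θ) • p₀ + c • (A z₁ - b)) (hp2 : p₂ = (1 - θ) • p₁ + c • (A z₂ - b))
    {t : ℝ} (ht : t ≤ 1 / 2) :
    lam / (2 * c) * (‖p₂ - p₁‖ ^ 2 - (1 - θ) ^ 2 * ‖p₁ - p₀‖ ^ 2)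
      ≤ lam * (1 - θ) * ⟪p₁ - p₀, A (z₂ - z₁)⟫_ℝ + (1 - t) * (lam * c * ‖A (z₂ - z₁)‖ ^ 2) := by
  have e1 : p₂ - p₁ = (1 - θ) • (p₁ - p₀) + c • A (z₂ - z₁) := by
    conv_lhs => rw [hp2]
    nth_rewrite 2 [hp1]
    rw [map_sub]
    module
  rw [e1, norm_add_sq_real, norm_smul, norm_smul, inner_smul_left, inner_smul_right, mul_pow,
    mul_pow]
  simp only [Real.norm_eq_abs, sq_abs, conj_trivial]
  have e2 : lam / (2 * c) * ((1 - θ) ^ 2 * ‖p₁ - p₀‖ ^ 2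
        + 2 * ((1 - θ) * (c * ⟪p₁ - p₀, A (z₂ - z₁)⟫_ℝ)) + c ^ 2 * ‖A (z₂ - z₁)‖ ^ 2
        - (1 - θ) ^ 2 * ‖p₁ - p₀‖ ^ 2)
      = lam * (1 - θ) * ⟪p₁ - p₀, A (z₂ - z₁)⟫_ℝ
        + 1 / 2 * (lam * c * ‖A (z₂ - z₁)‖ ^ 2) := by
    field_simp
    ring
  rw [e2]
  gcongr
  linarith

theorem multiplier_increment {p₁ p₂ : F} {z₂ : E}
    (hp2 : p₂ = (1 - θ) • p₁ + c • (A z₂ - b)) :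
    c * ((1 - θ) * ⟪p₂ - p₁, A z₂ - b⟫_ℝ)
      = (1 - θ) * (2 - θ) / 2 * ‖p₂ - p₁‖ ^ 2
        + θ * (1 - θ) / 2 * (‖p₂‖ ^ 2 - ‖p₁‖ ^ 2) := by
  have e1 : c • (A z₂ - b) = (p₂ - p₁) + θ • p₁ := by rw [hp2]; module
  have e2 : c * ⟪p₂ - p₁, A z₂ - b⟫_ℝ = ‖p₂ - p₁‖ ^ 2 + θ * ⟪p₂ - p₁, p₁⟫_ℝ := by
    rw [← inner_smul_right, e1, inner_add_right, inner_smul_right, real_inner_self_eq_norm_sq]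
  have e3 : ‖p₂‖ ^ 2 = ‖p₂ - p₁‖ ^ 2 + 2 * ⟪p₂ - p₁, p₁⟫_ℝ + ‖p₁‖ ^ 2 := by
    rw [← norm_add_sq_real, sub_add_cancel]
  rw [mul_left_comm, e2, e3]
  ring

/-- The potential that decreases, up to controlled errors, along the outer iterations. -/
def potential (φ : E → ℝ) (A : E →L[ℝ] F) (b : F) (lam θ c B : ℝ) (pm p : F) (zm z : E) : ℝ :=
  lam * augLag φ A b θ c p z
    + lam / c * (B * (1 - θ) ^ 2 / 2 * ‖p - pm‖ ^ 2 - θ * (1 - θ) / 2 * ‖p‖ ^ 2)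
    + B / 2 * ‖z - zm‖ ^ 2

/-- The coefficient of `‖r_{k-1}‖²` in the estimate of the potential. -/
def potentialLoss (B t s : ℝ) : ℝ := B * (1 / 2 * s * (1 + s) + s ^ 2 / (2 * t))

theorem inner_terms_le {t : ℝ} (ht0 : 0 < t) (hs : 0 ≤ s) {p₀ p₁ : F} {z₀ z₁ z₂ v₁ v₂ : E}
    {ε₁ ε₂ : ℝ} (h1 : InexactStep φ C A b lam θ c s p₀ z₀ z₁ v₁ ε₁)
    (h2 : InexactStep φ C A b lam θ c s p₁ z₁ z₂ v₂ ε₂) :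
    ⟪v₂ - v₁, z₂ - z₁⟫_ℝ + (ε₁ + ε₂) / t
      ≤ s * (1 + s) * (3 / 2 * ‖v₂ + z₁ - z₂‖ ^ 2 + 1 / 2 * ‖v₁ + z₀ - z₁‖ ^ 2)
        + s ^ 2 / (2 * t) * (‖v₁ + z₀ - z₁‖ ^ 2 + ‖v₂ + z₁ - z₂‖ ^ 2) := by
  have hv1 := h1.norm_residual_le hs
  have hv2 := h2.norm_residual_le hs
  have hz2 := h2.norm_step_le hs
  have hε1 : ε₁ ≤ s ^ 2 / 2 * ‖v₁ + z₀ - z₁‖ ^ 2 := by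
    have := h1.error; linarith [sq_nonneg ‖v₁‖]
  have hε2 : ε₂ ≤ s ^ 2 / 2 * ‖v₂ + z₁ - z₂‖ ^ 2 := by
    have := h2.error; linarith [sq_nonneg ‖v₂‖]
  have hvv : ⟪v₂ - v₁, z₂ - z₁⟫_ℝ ≤ (s * ‖v₂ + z₁ - z₂‖ + s * ‖v₁ + z₀ - z₁‖)
      * ((1 + s) * ‖v₂ + z₁ - z₂‖) := by
    refine (real_inner_le_norm _ _).trans ?_
    gcongr
    exact (norm_sub_le _ _).trans (by linarith)
  generalize ‖v₁ + z₀ - z₁‖ = ρ₁ at *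
  generalize ‖v₂ + z₁ - z₂‖ = ρ₂ at *
  refine add_le_add (hvv.trans ?_) ?_
  · have : (s * ρ₂ + s * ρ₁) * ((1 + s) * ρ₂) = s * (1 + s) * ((ρ₂ + ρ₁) * ρ₂) := by ring
    rw [this]
    gcongr
    linarith [sq_nonneg (ρ₂ - ρ₁)]
  · calc (ε₁ + ε₂) / t ≤ (s ^ 2 / 2 * ρ₁ ^ 2 + s ^ 2 / 2 * ρ₂ ^ 2) / t := by gcongr
      _ = s ^ 2 / (2 * t) * (ρ₁ ^ 2 + ρ₂ ^ 2) := by ring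

/-- This is what pays for the multiplier update: `two_steps` forces `‖p₂ - p₁‖²` to be at most `(1 -
θ)² ‖p₁ - p₀‖²`, up to a telescoping difference of squared steps and multiples of the squared
residuals. -/
theorem multiplier_estimate {m t : ℝ} (hφ : WeaklyConvexOn C φ m) (hlam : 0 < lam)
    (hC : Convex ℝ C) (hc : 0 < c) (ht0 : 0 < t) (ht : t ≤ 1 / 2) (hm : lam * m = t) (hs : 0 ≤ s)
    {p₀ p₁ p₂ : F} {z₀ z₁ z₂ v₁ v₂ : E} {ε₁ ε₂ : ℝ}
    (h1 : InexactStep φ C A b lam θ c s p₀ z₀ z₁ v₁ ε₁)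
    (h2 : InexactStep φ C A b lam θ c s p₁ z₁ z₂ v₂ ε₂)
    (hp1 : p₁ = (1 - θ) • p₀ + c • (A z₁ - b)) (hp2 : p₂ = (1 - θ) • p₁ + c • (A z₂ - b)) :
    lam / (2 * c) * (‖p₂ - p₁‖ ^ 2 - (1 - θ) ^ 2 * ‖p₁ - p₀‖ ^ 2)
      + 1 / 2 * ‖z₂ - z₁‖ ^ 2 - 1 / 2 * ‖z₁ - z₀‖ ^ 2
      ≤ s * (1 + s) * (3 / 2 * ‖v₂ + z₁ - z₂‖ ^ 2 + 1 / 2 * ‖v₁ + z₀ - z₁‖ ^ 2)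
        + s ^ 2 / (2 * t) * (‖v₁ + z₀ - z₁‖ ^ 2 + ‖v₂ + z₁ - z₂‖ ^ 2)
        + 2 * t * (1 + s) ^ 2 * ‖v₂ + z₁ - z₂‖ ^ 2 := by
  have hmon := InexactStep.two_steps hφ hlam.le hC h1 h2 ht0 (by linarith)
  have hcon := multiplier_contraction hc hlam.le hp1 hp2 ht
  have hin := inner_terms_le ht0 hs h1 h2
  have hz2 : ‖z₂ - z₁‖ ^ 2 ≤ (1 + s) ^ 2 * ‖v₂ + z₁ - z₂‖ ^ 2 := by
    rw [← mul_pow]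
    have := h2.norm_step_le hs
    gcongr
  have hzz : ⟪z₁ - z₀, z₂ - z₁⟫_ℝ ≤ 1 / 2 * ‖z₁ - z₀‖ ^ 2 + 1 / 2 * ‖z₂ - z₁‖ ^ 2 := by
    have := norm_sub_sq_real (z₁ - z₀) (z₂ - z₁)
    linarith [sq_nonneg ‖z₁ - z₀ - (z₂ - z₁)‖]
  rw [hm] at hmon
  -- With `lam * m = t` the curvature coefficient is `(1 - t)² = 1 - (2 t - t²)`; the deficit is
  -- charged to the residual.
  have h2t : (2 * t - t ^ 2) * ‖z₂ - z₁‖ ^ 2 ≤ 2 * t * (1 + s) ^ 2 * ‖v₂ + z₁ - z₂‖ ^ 2 := by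
    have h3 := mul_le_mul_of_nonneg_left hz2 (by linarith : 0 ≤ 2 * t)
    linarith [mul_nonneg (sq_nonneg t) (sq_nonneg ‖z₂ - z₁‖)]
  linarith

theorem augLag_multiplier_update (hc : 0 < c) {p₁ p₂ : F} {z₂ : E}
    (hp2 : p₂ = (1 - θ) • p₁ + c • (A z₂ - b)) :
    lam * augLag φ A b θ c p₂ z₂ = lam * augLag φ A b θ c p₁ z₂
      + lam / c * ((1 - θ) * (2 - θ) / 2 * ‖p₂ - p₁‖ ^ 2
        + θ * (1 - θ) / 2 * (‖p₂‖ ^ 2 - ‖p₁‖ ^ 2)) := by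
  rw [← multiplier_increment hp2]
  have : lam / c * (c * ((1 - θ) * ⟪p₂ - p₁, A z₂ - b⟫_ℝ))
    = lam * ((1 - θ) * ⟪p₂ - p₁, A z₂ - b⟫_ℝ) := by field_simp
  rw [this, inner_sub_left]
  unfold augLag
  ring

/-- Adds the descent of the proximal step, the cost of the multiplier update and `B` times
`multiplier_estimate`. The previous residual enters on the right only through `potentialLoss`, which
is carried along so that the inequality telescopes. -/
theorem potential_step {m B t : ℝ} (hφ : WeaklyConvexOn C φ m) (hlam : 0 < lam) (hC : Convex ℝ C)
    (hc : 0 < c) (hB : 0 ≤ B) (hBθ : B * θ = 1 - θ) (ht0 : 0 < t) (ht : t ≤ 1 / 2)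
    (hm : lam * m = t) (hs : 0 ≤ s)
    {p₀ p₁ p₂ : F} {z₀ z₁ z₂ v₁ v₂ : E} {ε₁ ε₂ : ℝ}
    (h1 : InexactStep φ C A b lam θ c s p₀ z₀ z₁ v₁ ε₁)
    (h2 : InexactStep φ C A b lam θ c s p₁ z₁ z₂ v₂ ε₂)
    (hp1 : p₁ = (1 - θ) • p₀ + c • (A z₁ - b)) (hp2 : p₂ = (1 - θ) • p₁ + c • (A z₂ - b)) :
    potential φ A b lam θ c B p₁ p₂ z₁ z₂ + potentialLoss B t s * ‖v₂ + z₁ - z₂‖ ^ 2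
        + (1 / 2 - s ^ 2 / 2 - B * (2 * t * (1 + s) ^ 2 + 2 * s * (1 + s) + s ^ 2 / t))
          * ‖v₂ + z₁ - z₂‖ ^ 2
      ≤ potential φ A b lam θ c B p₀ p₁ z₀ z₁ + potentialLoss B t s * ‖v₁ + z₀ - z₁‖ ^ 2 := by
  have hd := h2.descent h1.mem
  have hkey := mul_le_mul_of_nonneg_left
    (multiplier_estimate hφ hlam hC hc ht0 ht hm hs h1 h2 hp1 hp2) hB
  unfold potential potentialLoss
  rw [augLag_multiplier_update hc hp2]
  -- This identity dictates `B = (1 - θ) / θ`: the cost of the update must equal the decay gained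
  -- from the contraction factor `(1 - θ)²`.
  have hco : (1 - θ) * (2 - θ) / 2 = B * (1 - (1 - θ) ^ 2) / 2 := by
    linear_combination (-(2 - θ) / 2) * hBθ
  have e2 : s ^ 2 / t = 2 * (s ^ 2 / (2 * t)) := by ring
  have e3 : lam / (2 * c) = lam / c / 2 := by ring
  rw [hco, e2]
  rw [e3] at hkey
  generalize s ^ 2 / (2 * t) = σ' at *
  generalize lam / c = μ at *
  linarith

/-- The potential contains `-‖p‖²` but cannot run away: since `c (A z - b) = θ p + (1 - θ) (p -
pm)`, the multiplier terms combine to a multiple of the square of this vector. -/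
theorem le_potential {B cbar : ℝ} (hlam : 0 < lam) (hc : 0 < c) (hcc : cbar ≤ c) (hB : 0 ≤ B)
    (hBθ : B * θ = 1 - θ) {pm p : F} {zm z : E}
    (hp : p = (1 - θ) • pm + c • (A z - b)) :
    lam * (φ z + cbar / 2 * ‖A z - b‖ ^ 2) ≤ potential φ A b lam θ c B pm p zm z := by
  have e1 : c • (A z - b) = (1 - θ) • (p - pm) + θ • p := by
    conv_lhs => rw [eq_sub_of_add_eq' hp.symm]
    module
  have e2 : c * ⟪p, A z - b⟫_ℝ = (1 - θ) * ⟪p, p - pm⟫_ℝ + θ * ‖p‖ ^ 2 := by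
    rw [← inner_smul_right, e1, inner_add_right, inner_smul_right, inner_smul_right,
      real_inner_self_eq_norm_sq]
  have e3 : lam * ((1 - θ) * ⟪p, A z - b⟫_ℝ)
      = lam / c * ((1 - θ) * ((1 - θ) * ⟪p, p - pm⟫_ℝ + θ * ‖p‖ ^ 2)) := by
    rw [← e2]; field_simp
  have hsq : 0 ≤ (1 - θ) * ((1 - θ) * ⟪p, p - pm⟫_ℝ + θ * ‖p‖ ^ 2)
      + (B * (1 - θ) ^ 2 / 2 * ‖p - pm‖ ^ 2 - θ * (1 - θ) / 2 * ‖p‖ ^ 2) := by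
    have e4 := norm_add_sq_real (θ • p) ((1 - θ) • (p - pm))
    rw [norm_smul, norm_smul, mul_pow, mul_pow, inner_smul_left, inner_smul_right] at e4
    simp only [Real.norm_eq_abs, sq_abs, conj_trivial] at e4
    have e5 : (1 - θ) * ((1 - θ) * ⟪p, p - pm⟫_ℝ + θ * ‖p‖ ^ 2)
      + (B * (1 - θ) ^ 2 / 2 * ‖p - pm‖ ^ 2 - θ * (1 - θ) / 2 * ‖p‖ ^ 2)
      = B / 2 * ‖θ • p + (1 - θ) • (p - pm)‖ ^ 2 := by
      rw [e4, ← hBθ]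
      have : θ + B * θ = 1 := by linarith
      ring_nf
    rw [e5]
    positivity
  have h1 : lam * (cbar / 2 * ‖A z - b‖ ^ 2) ≤ lam * (c / 2 * ‖A z - b‖ ^ 2) := by gcongr
  have h2 : 0 ≤ B / 2 * ‖z - zm‖ ^ 2 := by positivity
  have h3 := mul_nonneg (div_pos hlam hc).le hsq
  unfold potential augLag
  rw [mul_add] at h3
  linarith

/-- The zero initial multiplier allows a comparison with arbitrary feasible points. The hypothesis
on `R` says only that it dominates every lower bound, so the infimum `R₀` need not be attained. The
factor `1 + 2 B` arises from the extra `B / 2` multiples of the penalty and of the squared first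
step. -/
theorem potential_first_step {B t cbar Φ R : ℝ} (hlam : 0 < lam)
    (hcc : 2 * cbar ≤ c) (hB : 0 ≤ B) (hBθ : B * θ = 1 - θ)
    (ht0 : 0 < t) (hs : 0 ≤ s) (hs1 : s ≤ 4 / 15)
    (hΦ : ∀ w ∈ C, Φ ≤ φ w + cbar / 2 * ‖A w - b‖ ^ 2)
    {p₁ : F} {z₀ z₁ v₁ : E} {ε₁ : ℝ}
    (hR : ∀ X : ℝ, (∀ w ∈ C, A w = b → X ≤ lam * (φ w - Φ) + ‖w - z₀‖ ^ 2) → X ≤ R)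
    (h1 : InexactStep φ C A b lam θ c s 0 z₀ z₁ v₁ ε₁) (hp1 : p₁ = c • (A z₁ - b)) :
    potential φ A b lam θ c B 0 p₁ z₀ z₁ - lam * Φ + potentialLoss B t s * ‖v₁ + z₀ - z₁‖ ^ 2
        + (1 / 2 - s ^ 2 - B * (2 * t * (1 + s) ^ 2 + 2 * s * (1 + s) + s ^ 2 / t))
          * ‖v₁ + z₀ - z₁‖ ^ 2
      ≤ (1 + 2 * B) * R := by
  have hf := hR (lam * (φ z₁ + c / 2 * ‖A z₁ - b‖ ^ 2)
      + (1 - 2 * s ^ 2) / 2 * ‖v₁ + z₀ - z₁‖ ^ 2 - lam * Φ) (fun w hw hwb => by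
    have := h1.le_of_feasible hw hwb
    linarith)
  have hlow := mul_le_mul_of_nonneg_left (hΦ z₁ h1.mem) hlam.le
  have hz := h1.norm_step_le hs
  have hz1 : ‖z₁ - z₀‖ ^ 2 ≤ (1 + s) ^ 2 * ‖v₁ + z₀ - z₁‖ ^ 2 := by
    rw [← mul_pow]; gcongr
  have hpot : potential φ A b lam θ c B 0 p₁ z₀ z₁
      = lam * (φ z₁ + c / 2 * ‖A z₁ - b‖ ^ 2) + B / 2 * (lam * c * ‖A z₁ - b‖ ^ 2)
        + B / 2 * ‖z₁ - z₀‖ ^ 2 := by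
    have e : θ * (1 + B) = 1 := by linarith
    have e' : (1 - θ) = B * θ := hBθ.symm
    unfold potential augLag
    rw [hp1, sub_zero, norm_smul, inner_smul_left, real_inner_self_eq_norm_sq, mul_pow]
    simp only [Real.norm_eq_abs, sq_abs, conj_trivial]
    rw [e']
    have hco : B * θ + B * (B * θ) ^ 2 / 2 - θ * (B * θ) / 2 = B / 2 := by
      have hB2 : B * θ = 1 - θ := hBθ
      have : B * θ + B * (B * θ) ^ 2 / 2 - θ * (B * θ) / 2 - B / 2
        = B / 2 * ((θ * (1 + B)) ^ 2 - 1) + B * θ * (1 - θ * (1 + B)) := by ring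
      rw [e] at this
      linarith
    rw [← hco]
    field_simp
    ring
  rw [hpot]
  set ρ := ‖v₁ + z₀ - z₁‖ ^ 2
  have hρ : 0 ≤ ρ := sq_nonneg _
  set N := ‖A z₁ - b‖ ^ 2
  have hN : 0 ≤ N := sq_nonneg _
  -- Since `2 cbar ≤ c`, half of the penalty `c / 2 * N` already suffices for the lower bound `Φ`;
  -- the other half, `c / 4 * N`, is at most the gap to `Φ`.
  have hcN : lam * c * N ≤ 4 * (lam * (φ z₁ + c / 2 * N) - lam * Φ) := by
    have : lam * (2 * cbar * N) ≤ lam * (c * N) := by gcongr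
    linarith
  have hBN := mul_le_mul_of_nonneg_left hcN hB
  have hBf := mul_le_mul_of_nonneg_left hf hB
  have hBz := mul_le_mul_of_nonneg_left hz1 hB
  have e2 : s ^ 2 / t = 2 * (s ^ 2 / (2 * t)) := by field_simp
  unfold potentialLoss
  rw [e2]
  have hq : 0 ≤ s ^ 2 / (2 * t) := by positivity
  generalize s ^ 2 / (2 * t) = σ' at *
  have hss : s ^ 2 ≤ (4 / 15) ^ 2 := by gcongr
  have hcoef : 0 ≤ B * (1 - 2 * s ^ 2 - 1 / 2 * (1 + s) ^ 2 + σ' + 2 * t * (1 + s) ^ 2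
      + 3 / 2 * s * (1 + s)) := by
    apply mul_nonneg hB
    have : 0 ≤ 2 * t * (1 + s) ^ 2 := by positivity
    have : 0 ≤ 3 / 2 * s * (1 + s) := by positivity
    nlinarith
  have := mul_nonneg hcoef hρ
  nlinarith

/-- The estimate for a run of inexact proximal steps on the `θ`-augmented Lagrangian: the last
iterate has a small penalized objective and the residuals are square summable. -/
theorem inexact_run_estimate {m B t cbar Φ R : ℝ} (hφ : WeaklyConvexOn C φ m) (hlam : 0 < lam)
    (hC : Convex ℝ C) (hc : 0 < c) (hcc : 2 * cbar ≤ c)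
    (hB : 0 ≤ B) (hBθ : B * θ = 1 - θ)
    (ht0 : 0 < t) (ht : t ≤ 1 / 2) (hm : lam * m = t) (hs : 0 ≤ s) (hs1 : s ≤ 4 / 15)
    (hΦ : ∀ w ∈ C, Φ ≤ φ w + cbar / 2 * ‖A w - b‖ ^ 2)
    {p : ℕ → F} {z v : ℕ → E} {ε : ℕ → ℝ} {N : ℕ}
    (hR : ∀ X : ℝ, (∀ w ∈ C, A w = b → X ≤ lam * (φ w - Φ) + ‖w - z 0‖ ^ 2) → X ≤ R)
    (hp0 : p 0 = 0) (hp : ∀ k < N + 1, p (k + 1) = (1 - θ) • p k + c • (A (z (k + 1)) - b))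
    (hstep : ∀ k < N + 1,
      InexactStep φ C A b lam θ c s (p k) (z k) (z (k + 1)) (v (k + 1)) (ε (k + 1))) :
    lam * (φ (z (N + 1)) + cbar / 2 * ‖A (z (N + 1)) - b‖ ^ 2 - Φ)
        + (1 / 2 - s ^ 2 - B * (2 * t * (1 + s) ^ 2 + 2 * s * (1 + s) + s ^ 2 / t))
          * ∑ k ∈ Finset.range (N + 1), ‖v (k + 1) + z k - z (k + 1)‖ ^ 2
      ≤ (1 + 2 * B) * R := by
  have hloss : 0 ≤ potentialLoss B t s := by unfold potentialLoss; positivity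
  have key : ∀ k < N + 1, potential φ A b lam θ c B (p k) (p (k + 1)) (z k) (z (k + 1)) - lam * Φ
      + potentialLoss B t s * ‖v (k + 1) + z k - z (k + 1)‖ ^ 2
      + (1 / 2 - s ^ 2 - B * (2 * t * (1 + s) ^ 2 + 2 * s * (1 + s) + s ^ 2 / t))
          * ∑ i ∈ Finset.range (k + 1), ‖v (i + 1) + z i - z (i + 1)‖ ^ 2
      ≤ (1 + 2 * B) * R := by
    intro k
    induction k with
    | zero =>
      intro hk
      have h0 := hstep 0 hk
      have hp1 := hp 0 hk
      rw [hp0] at h0 hp1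
      rw [smul_zero, zero_add (c • _)] at hp1
      have := potential_first_step (t := t) hlam hcc hB hBθ ht0 hs hs1 hΦ hR h0 hp1
      simpa [hp0] using this
    | succ k ih =>
      intro hk
      have h1 := ih (by omega)
      have h2 := potential_step hφ hlam hC hc hB hBθ ht0 ht hm hs (hstep k (by omega))
        (hstep (k + 1) hk) (hp k (by omega)) (hp (k + 1) hk)
      rw [Finset.sum_range_succ]
      nlinarith [mul_nonneg (sq_nonneg s)
        (sq_nonneg ‖v (k + 1 + 1) + z (k + 1) - z (k + 1 + 1)‖)]
  have h1 := key N (by omega)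
  have h2 := le_potential (cbar := cbar) (φ := φ) (zm := z N) hlam hc (by linarith) hB hBθ
    (hp N (by omega))
  have h3 := mul_nonneg hloss (sq_nonneg ‖v (N + 1) + z N - z (N + 1)‖)
  linarith

end InexactStep

theorem nonneg_of_forall_add_mul_nonneg {X Y : ℝ} (h : ∀ s : ℝ, 0 < s → s ≤ 1 → 0 ≤ X + s * Y) :
    0 ≤ X := by
  refine le_of_forall_pos_le_add fun ε hε => ?_
  have hY : 0 < |Y| + 1 := by positivity
  have h1 := h (min 1 (ε / (|Y| + 1))) (lt_min one_pos (by positivity)) (min_le_left _ _)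
  have h2 : min 1 (ε / (|Y| + 1)) * Y ≤ ε := by
    calc min 1 (ε / (|Y| + 1)) * Y ≤ min 1 (ε / (|Y| + 1)) * (|Y| + 1) := by
          gcongr
          linarith [le_abs_self Y]
      _ ≤ ε / (|Y| + 1) * (|Y| + 1) := by gcongr; exact min_le_right _ _
      _ = ε := by field_simp
  linarith

/-! ### Real-valued minimization on the effective domain -/

section Domain

variable {E : Type*}

theorem coe_toReal_of_mem_dom {h : E → EReal} (hbot : ∀ z, h z ≠ ⊥) {z : E} (hz : z ∈ dom h) :
    (((h z).toReal : ℝ) : EReal) = h z :=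
  EReal.coe_toReal (ne_of_lt hz) (hbot z)

/-- A minimizer of a real function plus an extended-real-valued one lies in the domain. -/
theorem mem_dom_of_le_coe_add {h : E → EReal} {r : ℝ} {z : E} {M : EReal}
    (hle : (r : EReal) + h z ≤ M) (hM : M < ⊤) : z ∈ dom h := by
  by_contra hz
  have : h z = ⊤ := not_lt_top_iff.1 hz
  rw [this, EReal.coe_add_top] at hle
  exact (hle.trans_lt hM).ne rfl

/-- A minimizer over the whole space, expressed with real-valued functions on the domain. -/
theorem isMinOn_coe_add_iff {h : E → EReal} (hbot : ∀ z, h z ≠ ⊥) {q : E → ℝ} {y : E}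
    (hne : (dom h).Nonempty) (hmin : IsMinOn (fun w => (q w : EReal) + h w) univ y) :
    y ∈ dom h ∧ ∀ w ∈ dom h, q y + (h y).toReal ≤ q w + (h w).toReal := by
  have hle : ∀ w, (q y : EReal) + h y ≤ q w + h w := fun w => hmin (mem_univ w)
  have hy : y ∈ dom h := by
    obtain ⟨x, hx⟩ := hne
    refine mem_dom_of_le_coe_add (hle x) ?_
    rw [← coe_toReal_of_mem_dom hbot hx, ← EReal.coe_add]
    exact EReal.coe_lt_top _
  refine ⟨hy, fun w hw => ?_⟩
  have := hle w
  rw [← coe_toReal_of_mem_dom hbot hy, ← coe_toReal_of_mem_dom hbot hw, ← EReal.coe_add,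
    ← EReal.coe_add] at this
  exact EReal.coe_le_coe_iff.1 this

end Domain

/-! ### Proximal optimality, ACG residuals and the descent lemma -/

section ConvexAnalysis

variable {E : Type*} [NormedAddCommGroup E] [InnerProductSpace ℝ E]

/-- The optimality condition for the proximal subproblem. -/
theorem subgradient_of_prox_isMinOn {C : Set E} {G : E → ℝ} (hG : ConvexOn ℝ C G) {κ : ℝ}
    {y₀ y : E} (hy : y ∈ C)
    (hmin : ∀ w ∈ C, G y + κ / 2 * ‖y - y₀‖ ^ 2 ≤ G w + κ / 2 * ‖w - y₀‖ ^ 2) {w : E}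
    (hw : w ∈ C) : G y + κ * ⟪y₀ - y, w - y⟫_ℝ ≤ G w := by
  suffices h : 0 ≤ G w - G y - κ * ⟪y₀ - y, w - y⟫_ℝ by linarith
  refine nonneg_of_forall_add_mul_nonneg (Y := κ / 2 * ‖w - y‖ ^ 2) fun s hs0 hs1 => ?_
  have h1 := hmin _ (hG.1 hy hw (by linarith : 0 ≤ 1 - s) hs0.le (by ring))
  have h2 := hG.2 hy hw (by linarith : 0 ≤ 1 - s) hs0.le (by ring)
  have e1 : (1 - s) • y + s • w - y₀ = s • (w - y) - (y₀ - y) := by module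
  have e2 : y - y₀ = -(y₀ - y) := by abel
  rw [e2, norm_neg, e1, norm_sub_sq_real (s • (w - y)), norm_smul, inner_smul_left, mul_pow,
    real_inner_comm] at h1
  simp only [Real.norm_eq_abs, sq_abs, conj_trivial] at h1
  simp only [smul_eq_mul] at h2
  refine le_of_mul_le_mul_left ?_ hs0
  linarith

theorem IsClosedProperConvex.convexOn {h : E → EReal} (hh : IsClosedProperConvex h) :
    ConvexOn ℝ (dom h) (fun z => (h z).toReal) := by
  have key : ∀ x ∈ dom h, ∀ y ∈ dom h, ∀ s t : ℝ, 0 < s → 0 < t → s + t = 1 →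
      h (s • x + t • y) ≤ ((s * (h x).toReal + t * (h y).toReal : ℝ) : EReal) := by
    intro x hx y hy s t hs ht hst
    have := hh.convex x y s t hs ht hst
    rwa [← coe_toReal_of_mem_dom hh.ne_bot hx, ← coe_toReal_of_mem_dom hh.ne_bot hy,
      ← EReal.coe_mul, ← EReal.coe_mul, ← EReal.coe_add] at this
  have hdom : Convex ℝ (dom h) := by
    rw [convex_iff_forall_pos]
    intro x hx y hy s t hs ht hst
    exact (key x hx y hy s t hs ht hst).trans_lt (EReal.coe_lt_top _)
  rw [convexOn_iff_forall_pos]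
  refine ⟨hdom, fun x hx y hy s t hs ht hst => ?_⟩
  have h1 := key x hx y hy s t hs ht hst
  rw [← coe_toReal_of_mem_dom hh.ne_bot (hdom hx hy hs.le ht.le hst)] at h1
  exact EReal.coe_le_coe_iff.1 h1

variable [CompleteSpace E]

/-- Every iterate of the ACG method is an inexact solution with the residuals it produces. -/
theorem IsACGRun.subgradient {ψs : E → ℝ} {ψn : E → EReal} {Ms μ : ℝ} {x₀ : E}
    {a : ℕ → ℝ} {x y : ℕ → E} {Γ : ℕ → E → ℝ} {u : ℕ → E} {η : ℕ → ℝ}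
    (hrun : IsACGRun ψs ψn Ms μ x₀ a x y Γ u η) (hbot : ∀ z, ψn z ≠ ⊥)
    (hconv : ConvexOn ℝ (dom ψn) (fun z => (ψn z).toReal))
    (hlin : ∀ z ∈ dom ψn, ∀ w ∈ dom ψn, linApprox ψs (dom ψn) z w ≤ ψs w)
    (hx₀ : x₀ ∈ dom ψn) (hMs : 0 < Ms) (hμ : 0 ≤ μ) {j : ℕ} (hj : 1 ≤ j) :
    x j ∈ dom ψn ∧ ∀ w ∈ dom ψn, ψs (x j) + (ψn (x j)).toReal + ⟪u j, w - x j⟫_ℝ - η j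
      ≤ ψs w + (ψn w).toReal := by
  have hastep : ∀ j, 0 ≤ a j → a j < a (j + 1) := by
    intro j hj
    rw [hrun.a_succ j, lt_add_iff_pos_right]
    have := Real.sqrt_nonneg ((μ * a j + 1) ^ 2 + 4 * Ms * (μ * a j + 1) * a j)
    have := mul_nonneg hμ hj
    exact div_pos (by linarith) (by linarith)
  have ha : ∀ j, 0 ≤ a j := by
    intro j
    induction j with
    | zero => exact hrun.a_zero.ge
    | succ j ih => exact ih.trans (hastep j ih).le
  have hapos : ∀ j, 0 < a (j + 1) := fun j => (ha j).trans_lt (hastep j (ha j))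
  have haff : ∀ j, ∃ (g : E) (r : ℝ), ∀ w, Γ j w = ⟪g, w⟫_ℝ + r := by
    intro j
    induction j with
    | zero => exact ⟨0, 0, fun w => by simp [hrun.Γ_zero]⟩
    | succ j ih =>
      obtain ⟨g, r, h⟩ := ih
      simp only [hrun.Γ_succ, h, linApprox]
      generalize (a j / a (j + 1)) • x j + ((a (j + 1) - a j) / a (j + 1)) • y j = xt
      refine ⟨(a j / a (j + 1)) • g
        + ((a (j + 1) - a j) / a (j + 1)) • gradientWithin ψs (dom ψn) xt,
        (a j / a (j + 1)) * r + ((a (j + 1) - a j) / a (j + 1))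
          * (ψs xt - ⟪gradientWithin ψs (dom ψn) xt, xt⟫_ℝ), fun w => ?_⟩
      rw [inner_add_left, inner_smul_left, inner_smul_left, inner_sub_right]
      simp only [conj_trivial]
      ring
  have hΓconv : ∀ j, ConvexOn ℝ (dom ψn) (Γ j) := by
    intro j
    obtain ⟨g, r, h⟩ := haff j
    refine ⟨hconv.1, fun z _ w _ s t _ _ hst => le_of_eq ?_⟩
    simp only [h, inner_add_right, inner_smul_right, smul_eq_mul]
    linear_combination (-r) * hst
  have hymin : ∀ j, y (j + 1) ∈ dom ψn ∧ ∀ w ∈ dom ψn,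
      Γ (j + 1) (y (j + 1)) + 1 / (2 * a (j + 1)) * ‖y (j + 1) - y 0‖ ^ 2
          + (ψn (y (j + 1))).toReal
        ≤ Γ (j + 1) w + 1 / (2 * a (j + 1)) * ‖w - y 0‖ ^ 2 + (ψn w).toReal := by
    intro j
    have h := hrun.y_succ j
    have e : (fun w => ((Γ (j + 1) w : ℝ) : EReal) + ψn w
        + ((1 / (2 * a (j + 1)) * ‖w - y 0‖ ^ 2 : ℝ) : EReal))
      = fun w => ((Γ (j + 1) w + 1 / (2 * a (j + 1)) * ‖w - y 0‖ ^ 2 : ℝ) : EReal) + ψn w := by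
      funext w
      rw [EReal.coe_add, add_right_comm]
    rw [e] at h
    exact isMinOn_coe_add_iff hbot ⟨x₀, hx₀⟩ h
  have hw1 : ∀ j, a j / a (j + 1) + (a (j + 1) - a j) / a (j + 1) = 1 := by
    intro j
    have := (hapos j).ne'
    field_simp
    ring
  have hwa : ∀ j, 0 ≤ a j / a (j + 1) := fun j => div_nonneg (ha j) (ha _)
  have hwb : ∀ j, 0 ≤ (a (j + 1) - a j) / a (j + 1) :=
    fun j => div_nonneg (sub_nonneg.2 (hastep j (ha j)).le) (ha _)
  have hy : ∀ j, y j ∈ dom ψn := by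
    rintro (_ | j)
    · rw [hrun.y_zero]; exact hx₀
    · exact (hymin j).1
  have hx : ∀ j, x j ∈ dom ψn := by
    intro j
    induction j with
    | zero => rw [hrun.x_zero]; exact hx₀
    | succ j ih =>
      rw [hrun.x_succ]
      exact hconv.1 ih (hy (j + 1)) (hwa j) (hwb j) (hw1 j)
  -- The index starts at one because `Γ 0 = 0` need not minorize `ψs`; as `a 0 = 0`, it has weight
  -- zero in `Γ 1`.
  have hΓle : ∀ j, ∀ w ∈ dom ψn, Γ (j + 1) w ≤ ψs w := by
    intro j
    induction j with
    | zero =>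
      intro w hw
      have h1 := hw1 0
      rw [hrun.Γ_succ, hrun.Γ_zero, mul_zero, zero_add]
      have h0 : a 0 / a (0 + 1) = 0 := by rw [hrun.a_zero, zero_div]
      rw [h0, zero_add] at h1
      rw [h0, h1, zero_smul, zero_add, one_smul, one_mul]
      exact hlin _ (hy 0) w hw
    | succ j ih =>
      intro w hw
      rw [hrun.Γ_succ]
      have h1 := hlin _ (hconv.1 (hx (j + 1)) (hy (j + 1)) (hwa (j + 1))
        (hwb (j + 1)) (hw1 (j + 1))) w hw
      calc _ ≤ (a (j + 1) / a (j + 1 + 1)) * ψs w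
            + ((a (j + 1 + 1) - a (j + 1)) / a (j + 1 + 1)) * ψs w :=
            add_le_add (mul_le_mul_of_nonneg_left (ih w hw) (hwa _))
              (mul_le_mul_of_nonneg_left h1 (hwb _))
        _ = ψs w := by rw [← add_mul, hw1, one_mul]
  refine ⟨hx j, fun w hw => ?_⟩
  obtain ⟨i, rfl⟩ : ∃ i, j = i + 1 := ⟨j - 1, by omega⟩
  have h1 := subgradient_of_prox_isMinOn ((hΓconv (i + 1)).add hconv) (κ := 1 / a (i + 1))
    (y₀ := y 0) (hy (i + 1)) (fun w hw => by
      have := (hymin i).2 w hw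
      have e : 1 / a (i + 1) / 2 = 1 / (2 * a (i + 1)) := by ring
      rw [e]
      simp only [Pi.add_apply]
      linarith) hw
  have h2 := hΓle i w hw
  -- The vector `u` is a subgradient of `Γ + ψn` at `y`, and `η` is exactly the error of moving the
  -- base point to `x` and replacing `Γ` by `ψs`.
  have e1 : 1 / a (i + 1) * ⟪y 0 - y (i + 1), w - y (i + 1)⟫_ℝ
      = ⟪u (i + 1), w - x (i + 1)⟫_ℝ + ⟪u (i + 1), x (i + 1) - y (i + 1)⟫_ℝ := by
    rw [← inner_add_right, sub_add_sub_cancel, hrun.u_succ, inner_smul_left]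
    simp
  rw [e1] at h1
  rw [hrun.η_succ]
  simp only [Pi.add_apply] at h1
  linarith

/-- The quadratic upper bound for a function with Lipschitz gradient on a convex set. -/
theorem le_quadratic_of_gradient_lipschitz {C : Set E} (hC : Convex ℝ C) {f : E → ℝ} {g : E → E}
    {L : ℝ} (hg : ∀ z ∈ C, HasGradientWithinAt f (g z) C z)
    (hL : ∀ z ∈ C, ∀ w ∈ C, ‖g w - g z‖ ≤ L * ‖w - z‖) {z w : E} (hz : z ∈ C) (hw : w ∈ C) :
    f w ≤ f z + ⟪g z, w - z⟫_ℝ + L / 2 * ‖w - z‖ ^ 2 := by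
  have hmem : ∀ t ∈ Icc (0 : ℝ) 1, z + t • (w - z) ∈ C := by
    intro t ht
    have := hC hz hw (sub_nonneg.2 ht.2) ht.1 (by ring)
    convert this using 1
    module
  have hd : ∀ t ∈ Icc (0 : ℝ) 1, HasDerivWithinAt (fun t : ℝ => f (z + t • (w - z)))
      ⟪g (z + t • (w - z)), w - z⟫_ℝ (Icc 0 1) t := by
    intro t ht
    have h1 := (hg _ (hmem t ht)).hasFDerivWithinAt
    have h2 : HasDerivWithinAt (fun t : ℝ => z + t • (w - z)) (w - z) (Icc 0 1) t := by
      have := ((hasDerivAt_id t).smul_const (w - z)).const_add z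
      simpa using this.hasDerivWithinAt
    have h3 := h1.comp_hasDerivWithinAt t h2 hmem
    rw [InnerProductSpace.toDual_apply_apply] at h3
    exact h3
  have hd' : ∀ t ∈ Icc (0 : ℝ) 1, HasDerivWithinAt (fun t : ℝ => f (z + t • (w - z))
      - t * ⟪g z, w - z⟫_ℝ - L / 2 * ‖w - z‖ ^ 2 * t ^ 2)
      (⟪g (z + t • (w - z)), w - z⟫_ℝ - ⟪g z, w - z⟫_ℝ - L / 2 * ‖w - z‖ ^ 2 * (2 * t))
      (Icc 0 1) t := by
    intro t ht
    refine ((hd t ht).sub ?_).sub ?_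
    · simpa using ((hasDerivAt_id t).mul_const ⟪g z, w - z⟫_ℝ).hasDerivWithinAt
    · simpa using ((hasDerivAt_pow 2 t).const_mul (L / 2 * ‖w - z‖ ^ 2)).hasDerivWithinAt
  have hanti := antitoneOn_of_hasDerivWithinAt_nonpos (convex_Icc (0 : ℝ) 1)
    (fun t ht => (hd' t ht).continuousWithinAt)
    (fun t ht => (hd' t (interior_subset ht)).mono interior_subset) (fun t ht => by
      have ht' := interior_subset ht
      have h1 := real_inner_le_norm (g (z + t • (w - z)) - g z) (w - z)
      have h2 := hL z hz _ (hmem t ht')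
      rw [add_sub_cancel_left, norm_smul, Real.norm_of_nonneg ht'.1] at h2
      have h3 := mul_le_mul_of_nonneg_right h2 (norm_nonneg (w - z))
      rw [inner_sub_left] at h1
      nlinarith)
  have := hanti (left_mem_Icc.2 zero_le_one) (right_mem_Icc.2 zero_le_one) zero_le_one
  simp only [one_smul, zero_smul, add_zero, add_sub_cancel] at this
  linarith

end ConvexAnalysis

/-! ### Scaling and real perturbation of extended-real-valued functions -/

section EReal

variable {E : Type*} {h : E → EReal} {lam : ℝ}

theorem dom_const_mul (hlam : 0 < lam) (hbot : ∀ z, h z ≠ ⊥) :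
    dom (fun w => (lam : EReal) * h w) = dom h := by
  ext z
  constructor
  · intro hz
    by_contra hn
    have : h z = ⊤ := not_lt_top_iff.1 hn
    have hz' : (lam : EReal) * h z < ⊤ := hz
    rw [this, EReal.coe_mul_top_of_pos hlam] at hz'
    exact hz'.ne rfl
  · intro hz
    change (lam : EReal) * h z < ⊤
    rw [← coe_toReal_of_mem_dom hbot hz, ← EReal.coe_mul]
    exact EReal.coe_lt_top _

theorem const_mul_ne_bot (hlam : 0 < lam) (hbot : ∀ z, h z ≠ ⊥) (z : E) :
    (lam : EReal) * h z ≠ ⊥ := by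
  by_cases hz : z ∈ dom h
  · rw [← coe_toReal_of_mem_dom hbot hz, ← EReal.coe_mul]
    exact EReal.coe_ne_bot _
  · have : h z = ⊤ := not_lt_top_iff.1 hz
    rw [this, EReal.coe_mul_top_of_pos hlam]
    exact top_ne_bot

theorem toReal_const_mul (z : E) :
    ((lam : EReal) * h z).toReal = lam * (h z).toReal := by
  rw [EReal.toReal_mul, EReal.toReal_coe]

theorem dom_add_coe (hbot : ∀ z, h z ≠ ⊥) (q : E → ℝ) :
    dom (fun w => h w + (q w : EReal)) = dom h := by
  ext z
  constructor
  · intro hz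
    refine mem_dom_of_le_coe_add (r := q z) (M := h z + (q z : EReal)) ?_ hz
    rw [add_comm]
  · intro hz
    change h z + (q z : EReal) < ⊤
    rw [← coe_toReal_of_mem_dom hbot hz, ← EReal.coe_add]
    exact EReal.coe_lt_top _

theorem add_coe_ne_bot (hbot : ∀ z, h z ≠ ⊥) (q : E → ℝ) (z : E) : h z + (q z : EReal) ≠ ⊥ := by
  simp [EReal.add_eq_bot_iff, hbot z]

theorem toReal_add_coe (hbot : ∀ z, h z ≠ ⊥) (q : E → ℝ) {z : E} (hz : z ∈ dom h) :
    (h z + (q z : EReal)).toReal = (h z).toReal + q z := by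
  rw [EReal.toReal_add (ne_of_lt hz) (hbot z) (EReal.coe_ne_top _) (EReal.coe_ne_bot _),
    EReal.toReal_coe]

end EReal

/-! ### Calculus of gradients relative to a set -/

section Gradient

variable {E F : Type*} [NormedAddCommGroup E] [InnerProductSpace ℝ E] [CompleteSpace E]
  [NormedAddCommGroup F] [InnerProductSpace ℝ F] [CompleteSpace F]

theorem gradientWithin_eq_of_hasGradientWithinAt {f : E → ℝ} {g x : E} {s : Set E}
    (h : HasGradientWithinAt f g s x) (hs : UniqueDiffWithinAt ℝ s x) :
    gradientWithin f s x = g := by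
  unfold gradientWithin
  rw [h.hasFDerivWithinAt.fderivWithin hs]
  simp

theorem hasGradientWithinAt_add {f₁ f₂ : E → ℝ} {g₁ g₂ x : E} {s : Set E}
    (h₁ : HasGradientWithinAt f₁ g₁ s x) (h₂ : HasGradientWithinAt f₂ g₂ s x) :
    HasGradientWithinAt (fun z => f₁ z + f₂ z) (g₁ + g₂) s x := by
  rw [hasGradientWithinAt_iff_hasFDerivWithinAt, map_add]
  exact h₁.hasFDerivWithinAt.add h₂.hasFDerivWithinAt

theorem hasGradientWithinAt_const_mul {f : E → ℝ} {g x : E} {s : Set E}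
    (h : HasGradientWithinAt f g s x) (r : ℝ) :
    HasGradientWithinAt (fun z => r * f z) (r • g) s x := by
  rw [hasGradientWithinAt_iff_hasFDerivWithinAt, map_smul]
  exact h.hasFDerivWithinAt.const_mul r

theorem hasGradientWithinAt_inner (p x : E) (s : Set E) :
    HasGradientWithinAt (fun z => ⟪p, z⟫_ℝ) p s x := by
  rw [hasGradientWithinAt_iff_hasFDerivWithinAt]
  exact (InnerProductSpace.toDual ℝ E p).hasFDerivWithinAt

theorem hasGradientWithinAt_inner_affine (A : E →L[ℝ] F) (b p : F) (x : E) (s : Set E) :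
    HasGradientWithinAt (fun z => ⟪p, A z - b⟫_ℝ) (ContinuousLinearMap.adjoint A p) s x := by
  rw [hasGradientWithinAt_iff_hasFDerivWithinAt]
  have e : (fun z => ⟪p, A z - b⟫_ℝ)
      = fun z => InnerProductSpace.toDual ℝ E (ContinuousLinearMap.adjoint A p) z - ⟪p, b⟫_ℝ := by
    funext z
    rw [InnerProductSpace.toDual_apply_apply, ContinuousLinearMap.adjoint_inner_left, inner_sub_right]
  rw [e]
  exact (InnerProductSpace.toDual ℝ E _).hasFDerivWithinAt.sub_const _

theorem hasGradientWithinAt_norm_sq_affine (A : E →L[ℝ] F) (b : F) (x : E) (s : Set E) :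
    HasGradientWithinAt (fun z => ‖A z - b‖ ^ 2)
      ((2 : ℝ) • ContinuousLinearMap.adjoint A (A x - b)) s x := by
  rw [hasGradientWithinAt_iff_hasFDerivWithinAt]
  have h := ((A.hasFDerivAt (x := x)).sub_const b).norm_sq
  refine h.hasFDerivWithinAt.congr_fderiv ?_
  ext w
  simp [ContinuousLinearMap.adjoint_inner_left, two_mul]

theorem hasGradientWithinAt_norm_sq_sub (x₀ x : E) (s : Set E) :
    HasGradientWithinAt (fun z => ‖z - x₀‖ ^ 2) ((2 : ℝ) • (x - x₀)) s x := by
  have h := hasGradientWithinAt_norm_sq_affine (ContinuousLinearMap.id ℝ E) x₀ x s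
  rw [ContinuousLinearMap.adjoint_id] at h
  simpa using h

end Gradient

/-! ### Smoothness of the augmented Lagrangian and the ACG step -/

namespace Problem

variable {n l : ℕ} {P : Problem n l} {L m cbar θ c lam : ℝ}

/-- The objective `f + h` as a real-valued function on `dom h`. -/
def obj (P : Problem n l) (z : EuclideanSpace ℝ (Fin n)) : ℝ := P.f z + (P.h z).toReal

/-- The gradient of the smooth part of the `θ`-augmented Lagrangian. -/
def gradAL (P : Problem n l) (θ c : ℝ) (p : EuclideanSpace ℝ (Fin l))
    (z : EuclideanSpace ℝ (Fin n)) : EuclideanSpace ℝ (Fin n) :=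
  P.gradf z + ContinuousLinearMap.adjoint P.A ((1 - θ) • p + c • (P.A z - P.b))

theorem augLag_obj (p : EuclideanSpace ℝ (Fin l)) (z : EuclideanSpace ℝ (Fin n)) :
    augLag P.obj P.A P.b θ c p z = P.smoothAL θ c p z + (P.h z).toReal := by
  unfold augLag obj smoothAL
  ring

theorem norm_adjoint_comp_le (P : Problem n l) (w : EuclideanSpace ℝ (Fin n)) :
    ‖ContinuousLinearMap.adjoint P.A (P.A w)‖ ≤ ‖P.A‖ ^ 2 * ‖w‖ := by
  calc _ ≤ ‖ContinuousLinearMap.adjoint P.A‖ * ‖P.A w‖ := ContinuousLinearMap.le_opNorm _ _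
    _ ≤ ‖P.A‖ * (‖P.A‖ * ‖w‖) := by
      rw [LinearIsometryEquiv.norm_map]
      gcongr
      exact P.A.le_opNorm _
    _ = _ := by ring

namespace BasicAssumptions

theorem convex_dom (hA : P.BasicAssumptions L m cbar) : Convex ℝ (dom P.h) :=
  hA.h_closed_proper_convex.convexOn.1

theorem hasGradientWithinAt_smoothAL (hA : P.BasicAssumptions L m cbar)
    (p : EuclideanSpace ℝ (Fin l)) {z : EuclideanSpace ℝ (Fin n)} (hz : z ∈ dom P.h) :
    HasGradientWithinAt (P.smoothAL θ c p) (P.gradAL θ c p z) (dom P.h) z := by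
  have h1 : HasGradientWithinAt P.f (P.gradf z) (dom P.h) z := (hA.f_diff z hz).hasGradientWithinAt
  have h2 := hasGradientWithinAt_const_mul
    (hasGradientWithinAt_inner_affine P.A P.b p z (dom P.h)) (1 - θ)
  have h3 := hasGradientWithinAt_const_mul
    (hasGradientWithinAt_norm_sq_affine P.A P.b z (dom P.h)) (c / 2)
  have h4 := hasGradientWithinAt_add (hasGradientWithinAt_add h1 h2) h3
  have e : P.gradAL θ c p z = P.gradf z + (1 - θ) • ContinuousLinearMap.adjoint P.A p
      + (c / 2) • (2 : ℝ) • ContinuousLinearMap.adjoint P.A (P.A z - P.b) := by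
    rw [gradAL, map_add, map_smul, map_smul]
    module
  rw [e]
  exact h4

/-- The multiplier term is affine and the penalty is convex, so the lower curvature constant `m` of
`f` survives, independently of `c` and `p`. -/
theorem smoothAL_lower (hA : P.BasicAssumptions L m cbar) (hc : 0 ≤ c)
    (p : EuclideanSpace ℝ (Fin l)) {z w : EuclideanSpace ℝ (Fin n)} (hz : z ∈ dom P.h)
    (hw : w ∈ dom P.h) :
    P.smoothAL θ c p z + ⟪P.gradAL θ c p z, w - z⟫_ℝ - m / 2 * ‖w - z‖ ^ 2
      ≤ P.smoothAL θ c p w := by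
  have h1 := hA.lower_curvature z hz w hw
  have e : P.A w - P.b = (P.A z - P.b) + P.A (w - z) := by simp
  unfold smoothAL gradAL
  rw [e, norm_add_sq_real, inner_add_left (P.gradf z), ContinuousLinearMap.adjoint_inner_left,
    inner_add_left, inner_add_right, inner_smul_left, inner_smul_left]
  simp only [conj_trivial]
  have : 0 ≤ c / 2 * ‖P.A (w - z)‖ ^ 2 := by positivity
  linarith

theorem smoothAL_upper (hA : P.BasicAssumptions L m cbar) (hc : 0 ≤ c)
    (p : EuclideanSpace ℝ (Fin l)) {z w : EuclideanSpace ℝ (Fin n)} (hz : z ∈ dom P.h)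
    (hw : w ∈ dom P.h) :
    P.smoothAL θ c p w ≤ P.smoothAL θ c p z + ⟪P.gradAL θ c p z, w - z⟫_ℝ
      + P.Lc L c / 2 * ‖w - z‖ ^ 2 := by
  have h1 := le_quadratic_of_gradient_lipschitz hA.convex_dom
    (fun z hz => (hA.f_diff z hz).hasGradientWithinAt) hA.grad_lipschitz hz hw
  change P.f w ≤ P.f z + ⟪P.gradf z, w - z⟫_ℝ + L / 2 * ‖w - z‖ ^ 2 at h1
  have e : P.A w - P.b = (P.A z - P.b) + P.A (w - z) := by simp
  unfold smoothAL gradAL Lc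
  rw [e, norm_add_sq_real, inner_add_left (P.gradf z), ContinuousLinearMap.adjoint_inner_left,
    inner_add_left, inner_add_right, inner_smul_left, inner_smul_left]
  simp only [conj_trivial]
  have : c / 2 * ‖P.A (w - z)‖ ^ 2 ≤ c / 2 * (‖P.A‖ * ‖w - z‖) ^ 2 := by
    gcongr
    exact P.A.le_opNorm _
  linarith

theorem gradAL_lipschitz (hA : P.BasicAssumptions L m cbar) (hc : 0 ≤ c)
    (p : EuclideanSpace ℝ (Fin l)) {z w : EuclideanSpace ℝ (Fin n)} (hz : z ∈ dom P.h)
    (hw : w ∈ dom P.h) : ‖P.gradAL θ c p w - P.gradAL θ c p z‖ ≤ P.Lc L c * ‖w - z‖ := by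
  have e : P.gradAL θ c p w - P.gradAL θ c p z = (P.gradf w - P.gradf z)
      + c • ContinuousLinearMap.adjoint P.A (P.A (w - z)) := by
    simp only [gradAL, map_add, map_smul, map_sub]
    module
  rw [e]
  refine (norm_add_le _ _).trans ?_
  rw [norm_smul, Real.norm_of_nonneg hc, Lc, add_mul, mul_assoc]
  exact add_le_add (hA.grad_lipschitz z hz w hw)
    (mul_le_mul_of_nonneg_left (norm_adjoint_comp_le P _) hc)

theorem weaklyConvexOn_obj (hA : P.BasicAssumptions L m cbar) :
    WeaklyConvexOn (dom P.h) P.obj m := by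
  intro z hz w hw t ht0 ht1
  have hx : (1 - t) • z + t • w ∈ dom P.h :=
    hA.convex_dom hz hw (by linarith) ht0.le (by ring)
  have h1 := hA.lower_curvature _ hx z hz
  have h2 := hA.lower_curvature _ hx w hw
  have h3 := hA.h_closed_proper_convex.convexOn.2 hz hw (by linarith : 0 ≤ 1 - t) ht0.le (by ring)
  have e1 : z - ((1 - t) • z + t • w) = (-t) • (w - z) := by module
  have e2 : w - ((1 - t) • z + t • w) = (1 - t) • (w - z) := by module
  rw [e1, norm_smul, mul_pow, inner_smul_right, Real.norm_eq_abs, sq_abs] at h1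
  rw [e2, norm_smul, mul_pow, inner_smul_right, Real.norm_eq_abs, sq_abs] at h2
  simp only [smul_eq_mul] at h3
  have h4 := mul_le_mul_of_nonneg_left h1 (by linarith : 0 ≤ 1 - t)
  have h5 := mul_le_mul_of_nonneg_left h2 ht0.le
  unfold obj
  nlinarith

/-- The iterates of the ACG method accepted in the first step are inexact proximal points. -/
theorem inexactStep (hA : P.BasicAssumptions L m cbar)
    (hint : (interior (dom P.h)).Nonempty) (hc : 0 ≤ c) (hlam : 0 < lam)
    (hm : lam * m = tau θ) (hτ : tau θ ≤ 1)
    {p : EuclideanSpace ℝ (Fin l)} {zm z v : EuclideanSpace ℝ (Fin n)} {ε : ℝ}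
    (hzm : zm ∈ dom P.h) (h : P.IsStep1 L θ lam c p zm z v ε) :
    InexactStep P.obj (dom P.h) P.A P.b lam θ c (P.sigma L θ lam c) p zm z v ε := by
  obtain ⟨⟨a, x, y, Γ, u, η, hrun, j, hj, rfl, rfl, rfl⟩, herr⟩ := h
  have hbot := hA.h_closed_proper_convex.ne_bot
  have hL : 0 < L := hA.m_pos.trans_le hA.m_le_L
  have hτ0 : 0 < tau θ := hm ▸ mul_pos hlam hA.m_pos
  have hbot' := const_mul_ne_bot hlam hbot
  have hdom : dom (fun w => (lam : EReal) * P.h w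
      + (((1 - tau θ) / 2 * ‖w - zm‖ ^ 2 : ℝ) : EReal)) = dom P.h := by
    rw [dom_add_coe hbot', dom_const_mul hlam hbot]
  have hreal : ∀ w ∈ dom P.h, ((lam : EReal) * P.h w
      + (((1 - tau θ) / 2 * ‖w - zm‖ ^ 2 : ℝ) : EReal)).toReal
      = lam * (P.h w).toReal + (1 - tau θ) / 2 * ‖w - zm‖ ^ 2 := by
    intro w hw
    rw [toReal_add_coe (h := fun w => (lam : EReal) * P.h w) hbot'
      (fun w => (1 - tau θ) / 2 * ‖w - zm‖ ^ 2) (by rwa [dom_const_mul hlam hbot]),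
      toReal_const_mul]
  have hconv : ConvexOn ℝ (dom P.h)
      (fun w => lam * (P.h w).toReal + (1 - tau θ) / 2 * ‖w - zm‖ ^ 2) := by
    refine (hA.h_closed_proper_convex.convexOn.smul hlam.le).add ?_
    refine ConvexOn.smul (c := (1 - tau θ) / 2) (by linarith) ?_
    have h1 : ConvexOn ℝ (dom P.h) (fun w => ‖w - zm‖) := by
      have := (convexOn_norm (convex_univ (𝕜 := ℝ) (E := EuclideanSpace ℝ (Fin n)))).translate_left
        (-zm)
      refine (this.subset (by simp) hA.convex_dom).congr fun w _ => ?_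
      simp [sub_eq_add_neg]
    exact h1.pow (fun w _ => norm_nonneg _) 2
  obtain ⟨hx, hsub⟩ := hrun.subgradient (add_coe_ne_bot hbot' _)
    (by rw [hdom]; exact hconv.congr fun w hw => (hreal w hw).symm)
    (by
      rw [hdom]
      intro z hz w hw
      have hg := hasGradientWithinAt_add
        (hasGradientWithinAt_const_mul (hA.hasGradientWithinAt_smoothAL (θ := θ) (c := c) p hz) lam)
        (hasGradientWithinAt_const_mul (hasGradientWithinAt_norm_sq_sub zm z (dom P.h)) (tau θ / 2))
      have hg' := gradientWithin_eq_of_hasGradientWithinAt hg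
        (uniqueDiffOn_convex hA.convex_dom hint z hz)
      rw [linApprox, hg']
      have h1 := mul_le_mul_of_nonneg_left (hA.smoothAL_lower (θ := θ) hc p hz hw) hlam.le
      have e1 : w - zm = (z - zm) + (w - z) := by abel
      rw [e1, norm_add_sq_real, inner_add_left, inner_smul_left, inner_smul_left, inner_smul_left]
      simp only [conj_trivial]
      -- As `lam * m = tau θ`, the part of the proximal term placed in `ψs` cancels the negative
      -- curvature exactly, so linearizations of `ψs` are minorants.
      have e2 : lam * (m / 2 * ‖w - z‖ ^ 2) = tau θ / 2 * ‖w - z‖ ^ 2 := by rw [← hm]; ring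
      linarith)
    (by rw [hdom]; exact hzm)
    (by
      have : 0 ≤ lam * P.Lc L c := by unfold Lc; positivity
      linarith)
    (by linarith) hj
  rw [hdom] at hx hsub
  refine ⟨hx, fun w hw => ?_, herr⟩
  have h1 := hsub w hw
  rw [hreal w hw, hreal _ hx] at h1
  rw [augLag_obj, augLag_obj]
  linarith

end BasicAssumptions

end Problem

/-! ### The refinement step -/

namespace Problem

variable {n l : ℕ} {P : Problem n l} {L m cbar θ c lam s : ℝ}

namespace BasicAssumptions

/-- The optimality condition of the refinement step. -/
theorem refinement_optimality (hA : P.BasicAssumptions L m cbar)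
    (hint : (interior (dom P.h)).Nonempty) (hlam : 0 < lam)
    {p : EuclideanSpace ℝ (Fin l)} {zm z v zh vh : EuclideanSpace ℝ (Fin n)}
    (hz : z ∈ dom P.h)
    (hr : IsRefinement (P.smoothAL θ c p) P.h (P.Lc L c) lam zm z v zh vh) :
    zh ∈ dom P.h ∧ ∀ w ∈ dom P.h,
      lam * (P.h zh).toReal + ⟪lam • P.gradAL θ c p z - (v + zm - z), zh - w⟫_ℝ
        + (lam * P.Lc L c + 1) * ⟪z - zh, w - zh⟫_ℝ ≤ lam * (P.h w).toReal := by
  have hbot := hA.h_closed_proper_convex.ne_bot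
  have hbot' := const_mul_ne_bot hlam hbot
  have hdom := dom_const_mul hlam hbot
  have hg : gradientWithin (fun x => lam * P.smoothAL θ c p x + 1 / 2 * ‖x - zm‖ ^ 2 - ⟪v, x⟫_ℝ)
      (dom P.h) z = lam • P.gradAL θ c p z - (v + zm - z) := by
    have h1 := hasGradientWithinAt_add (hasGradientWithinAt_add
      (hasGradientWithinAt_const_mul (hA.hasGradientWithinAt_smoothAL (θ := θ) (c := c) p hz) lam)
      (hasGradientWithinAt_const_mul (hasGradientWithinAt_norm_sq_sub zm z (dom P.h)) (1 / 2)))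
      (hasGradientWithinAt_inner (-v) z (dom P.h))
    simp only [inner_neg_left, ← sub_eq_add_neg] at h1
    rw [gradientWithin_eq_of_hasGradientWithinAt h1 (uniqueDiffOn_convex hA.convex_dom hint z hz)]
    module
  have hmin := hr.argmin
  rw [hg] at hmin
  obtain ⟨hzh, hmin'⟩ := isMinOn_coe_add_iff (h := fun w => (lam : EReal) * P.h w) hbot'
    (by rw [hdom]; exact ⟨z, hz⟩) hmin
  rw [hdom] at hzh hmin'
  simp only [toReal_const_mul] at hmin'
  refine ⟨hzh, fun w hw => ?_⟩
  set g := lam • P.gradAL θ c p z - (v + zm - z)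
  have hconv : ConvexOn ℝ (dom P.h) (fun w => lam * (P.h w).toReal + ⟪g, w - z⟫_ℝ) := by
    refine (hA.h_closed_proper_convex.convexOn.smul hlam.le).add ?_
    refine ⟨hA.convex_dom, fun x _ y _ a b _ _ hab => le_of_eq ?_⟩
    simp only [inner_sub_right, inner_add_right, inner_smul_right, smul_eq_mul]
    linear_combination (⟪g, z⟫_ℝ) * hab
  have := subgradient_of_prox_isMinOn hconv (κ := lam * P.Lc L c + 1) (y₀ := z) hzh
    (fun w hw => by have := hmin' w hw; linarith) hw
  have e : zh - w = (zh - z) - (w - z) := by abel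
  rw [e, inner_sub_right]
  linarith

/-- The refined residual is the sum of the gradient and of a subgradient at the refined point. -/
theorem refinement_subgradient (hA : P.BasicAssumptions L m cbar)
    (hint : (interior (dom P.h)).Nonempty) (hlam : 0 < lam)
    {p : EuclideanSpace ℝ (Fin l)} {zm z v zh vh : EuclideanSpace ℝ (Fin n)}
    (hz : z ∈ dom P.h)
    (hr : IsRefinement (P.smoothAL θ c p) P.h (P.Lc L c) lam zm z v zh vh) :
    ∃ ξ ∈ subdiff P.h zh, vh = P.gradf zh + ξ
      + ContinuousLinearMap.adjoint P.A ((1 - θ) • p + c • (P.A zh - P.b)) := by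
  obtain ⟨hzh, hopt⟩ := hA.refinement_optimality hint hlam hz hr
  have hbot := hA.h_closed_proper_convex.ne_bot
  have hud := uniqueDiffOn_convex hA.convex_dom hint
  have hres := hr.residual
  rw [gradientWithin_eq_of_hasGradientWithinAt (hA.hasGradientWithinAt_smoothAL p hz) (hud z hz),
    gradientWithin_eq_of_hasGradientWithinAt (hA.hasGradientWithinAt_smoothAL p hzh)
      (hud zh hzh)] at hres
  refine ⟨(1 / lam) • ((v + zm - z) + (lam * P.Lc L c + 1) • (z - zh)) - P.gradAL θ c p z,
    fun w => ?_, ?_⟩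
  · by_cases hw : w ∈ dom P.h
    · have h1 := hopt w hw
      rw [← coe_toReal_of_mem_dom hbot hw, ← coe_toReal_of_mem_dom hbot hzh, ← EReal.coe_add,
        EReal.coe_le_coe_iff]
      have e : zh - w = -(w - zh) := by abel
      rw [e, inner_neg_right, inner_sub_left, inner_smul_left] at h1
      rw [inner_sub_left, inner_smul_left, inner_add_left, inner_smul_left]
      simp only [conj_trivial] at h1 ⊢
      refine le_of_mul_le_mul_left ?_ hlam
      rw [mul_add, mul_sub, ← mul_assoc lam (1 / lam), mul_one_div_cancel hlam.ne', one_mul]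
      linarith
    · have : P.h w = ⊤ := not_lt_top_iff.1 hw
      rw [this]
      exact le_top
  · rw [hres]
    simp only [gradAL]
    abel

/-- The refined point is again an inexact solution of the proximal subproblem. -/
theorem refinement_inexactStep (hA : P.BasicAssumptions L m cbar)
    (hint : (interior (dom P.h)).Nonempty) (hc : 0 ≤ c) (hlam : 0 < lam)
    {p : EuclideanSpace ℝ (Fin l)} {zm z v zh vh : EuclideanSpace ℝ (Fin n)} {ε : ℝ}
    (hs : 0 ≤ s) (hs1 : s ≤ 1 / 4)
    (hstep : InexactStep P.obj (dom P.h) P.A P.b lam θ c s p zm z v ε)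
    (hr : IsRefinement (P.smoothAL θ c p) P.h (P.Lc L c) lam zm z v zh vh) :
    (∃ ε', InexactStep P.obj (dom P.h) P.A P.b lam θ c (16 / 15 * s) p zm zh v ε') ∧
      (lam * P.Lc L c + 1) * ‖zh - z‖ ^ 2 ≤ s ^ 2 * ‖v + zm - z‖ ^ 2 := by
  have hz := hstep.mem
  obtain ⟨hzh, hopt⟩ := hA.refinement_optimality hint hlam hz hr
  have hL : 0 < L := hA.m_pos.trans_le hA.m_le_L
  have hM : 1 ≤ lam * P.Lc L c + 1 := by
    have : 0 ≤ lam * P.Lc L c := by unfold Lc; positivity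
    linarith
  have h1 := hopt z hz
  have h2 := mul_le_mul_of_nonneg_left (hA.smoothAL_upper (θ := θ) hc p hz hzh) hlam.le
  have h3 := hstep.subgrad zh hzh
  have h4 := hstep.error
  rw [real_inner_self_eq_norm_sq, norm_sub_rev z zh] at h1
  have e1 : zh - zm = (z - zm) + (zh - z) := by abel
  have e2 : ‖zh - zm‖ ^ 2 = ‖z - zm‖ ^ 2 + 2 * ⟪z - zm, zh - z⟫_ℝ + ‖zh - z‖ ^ 2 := by
    rw [e1, norm_add_sq_real]
  have e3 : ⟪lam • P.gradAL θ c p z - (v + zm - z), zh - z⟫_ℝ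
      = lam * ⟪P.gradAL θ c p z, zh - z⟫_ℝ - ⟪v, zh - z⟫_ℝ + ⟪z - zm, zh - z⟫_ℝ := by
    simp only [inner_sub_left, inner_add_left, inner_smul_left, conj_trivial]
    ring
  rw [e3] at h1
  have hdec : lam * augLag P.obj P.A P.b θ c p zh + 1 / 2 * ‖zh - zm‖ ^ 2 - ⟪v, zh - z⟫_ℝ
      + (lam * P.Lc L c + 1) / 2 * ‖zh - z‖ ^ 2
      ≤ lam * augLag P.obj P.A P.b θ c p z + 1 / 2 * ‖z - zm‖ ^ 2 := by
    rw [augLag_obj, augLag_obj, e2]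
    linarith
  -- The new tolerance is `ε` plus the change of the subproblem objective, tilted by `v`, from `z`
  -- to `zh`. By `hdec` it is at most `ε - (lam L_c + 1) / 2 * ‖zh - z‖²`; this gain absorbs the
  -- change in the residual.
  refine ⟨⟨ε + (lam * augLag P.obj P.A P.b θ c p zh + 1 / 2 * ‖zh - zm‖ ^ 2)
    - (lam * augLag P.obj P.A P.b θ c p z + 1 / 2 * ‖z - zm‖ ^ 2) - ⟪v, zh - z⟫_ℝ, hzh,
    fun w hw => ?_, ?_⟩, ?_⟩
  · have h5 := hstep.subgrad w hw
    have e : w - z = (w - zh) + (zh - z) := by abel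
    rw [e, inner_add_right] at h5
    linarith
  · have hr : ‖v + zm - z‖ ≤ ‖v + zm - zh‖ + ‖zh - z‖ := by
      have e : v + zm - z = (v + zm - zh) + (zh - z) := by abel
      rw [e]
      exact norm_add_le _ _
    have hr2 : s ^ 2 * ‖v + zm - z‖ ^ 2 ≤ s ^ 2 * (‖v + zm - zh‖ + ‖zh - z‖) ^ 2 := by gcongr
    have hd : ‖zh - z‖ ^ 2 ≤ (lam * P.Lc L c + 1) * ‖zh - z‖ ^ 2 :=
      le_mul_of_one_le_left (sq_nonneg _) hM
    suffices s ^ 2 * (‖v + zm - zh‖ + ‖zh - z‖) ^ 2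
        ≤ (16 / 15 * s) ^ 2 * ‖v + zm - zh‖ ^ 2 + ‖zh - z‖ ^ 2 by linarith
    generalize ‖v + zm - zh‖ = x
    generalize ‖zh - z‖ = y
    have hs2 : s ^ 2 ≤ 1 / 16 := by
      calc s ^ 2 ≤ (1 / 4) ^ 2 := by gcongr
        _ = 1 / 16 := by norm_num
    -- Young's inequality weighted so that `s² ≤ 1/16` turns `16 y²` into at most `y²`, which the
    -- gain covers; this fixes the factor `16/15`.
    have h6 : (x + y) ^ 2 ≤ 16 / 15 * x ^ 2 + 16 * y ^ 2 := by
      nlinarith [sq_nonneg (x - 15 * y)]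
    have h7 := mul_le_mul_of_nonneg_left h6 (sq_nonneg s)
    have h8 := mul_le_mul_of_nonneg_right hs2 (sq_nonneg y)
    have h9 := mul_nonneg (sq_nonneg s) (sq_nonneg x)
    linarith
  · linarith [sq_nonneg ‖v‖]

/-- The bound `s ≤ (lam L_c + 1)^{-1/2}` upgrades an estimate with one factor `lam L_c + 1` on the
square to one with that factor on the norm itself. This later makes all multiplier bounds
independent of `c`. -/
theorem norm_refinement_le (hA : P.BasicAssumptions L m cbar) (hc : 0 ≤ c) (hlam : 0 < lam)
    {zm z v zh : EuclideanSpace ℝ (Fin n)}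
    (hs : 0 ≤ s) (hs1 : s ≤ 1 / √(lam * P.Lc L c + 1))
    (hd : (lam * P.Lc L c + 1) * ‖zh - z‖ ^ 2 ≤ s ^ 2 * ‖v + zm - z‖ ^ 2) :
    (lam * P.Lc L c + 1) * ‖zh - z‖ ≤ ‖v + zm - z‖ := by
  have hL : 0 < L := hA.m_pos.trans_le hA.m_le_L
  have hM : 0 < lam * P.Lc L c + 1 := by
    unfold Lc; positivity
  generalize lam * P.Lc L c + 1 = M at *
  have h1 : s ^ 2 ≤ 1 / M := by
    calc s ^ 2 ≤ (1 / √M) ^ 2 := by gcongr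
      _ = 1 / M := by rw [div_pow, Real.sq_sqrt hM.le, one_pow]
  refine abs_le_of_sq_le_sq' ?_ (norm_nonneg _) |>.2
  calc (M * ‖zh - z‖) ^ 2 = M * (M * ‖zh - z‖ ^ 2) := by ring
    _ ≤ M * (s ^ 2 * ‖v + zm - z‖ ^ 2) := by gcongr
    _ ≤ M * (1 / M * ‖v + zm - z‖ ^ 2) := by gcongr
    _ = ‖v + zm - z‖ ^ 2 := by field_simp

/-- The refined residual is controlled by the residual of the inexact step. -/
theorem norm_refined_residual_le (hA : P.BasicAssumptions L m cbar)
    (hint : (interior (dom P.h)).Nonempty) (hc : 0 ≤ c) (hlam : 0 < lam)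
    {p : EuclideanSpace ℝ (Fin l)} {zm z v zh vh : EuclideanSpace ℝ (Fin n)}
    (hz : z ∈ dom P.h)
    (hr : IsRefinement (P.smoothAL θ c p) P.h (P.Lc L c) lam zm z v zh vh)
    (hd : (lam * P.Lc L c + 1) * ‖zh - z‖ ≤ ‖v + zm - z‖) :
    ‖vh‖ ≤ 3 / lam * ‖v + zm - z‖ := by
  obtain ⟨hzh, -⟩ := hA.refinement_optimality hint hlam hz hr
  have hL : 0 < L := hA.m_pos.trans_le hA.m_le_L
  have hM : 0 < lam * P.Lc L c + 1 := by
    unfold Lc; positivity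
  have hud := uniqueDiffOn_convex hA.convex_dom hint
  have hres := hr.residual
  rw [gradientWithin_eq_of_hasGradientWithinAt (hA.hasGradientWithinAt_smoothAL p hz) (hud z hz),
    gradientWithin_eq_of_hasGradientWithinAt (hA.hasGradientWithinAt_smoothAL p hzh)
      (hud zh hzh), add_sub_assoc] at hres
  have h1 := hA.gradAL_lipschitz (θ := θ) hc p hz hzh
  have h2 : ‖(1 / lam) • ((v + zm - z) + (lam * P.Lc L c + 1) • (z - zh))‖
      ≤ 1 / lam * (2 * ‖v + zm - z‖) := by
    rw [norm_smul, Real.norm_of_nonneg (by positivity)]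
    gcongr
    refine (norm_add_le _ _).trans ?_
    rw [norm_smul, Real.norm_of_nonneg hM.le, norm_sub_rev z zh]
    linarith
  have h3 : P.Lc L c * ‖zh - z‖ ≤ 1 / lam * ‖v + zm - z‖ := by
    rw [one_div, ← div_eq_inv_mul, le_div_iff₀ hlam]
    linarith [norm_nonneg (zh - z)]
  rw [hres]
  calc _ ≤ 1 / lam * (2 * ‖v + zm - z‖) + 1 / lam * ‖v + zm - z‖ :=
        (norm_add_le _ _).trans (add_le_add h2 (h1.trans h3))
    _ = 3 / lam * ‖v + zm - z‖ := by ring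

end BasicAssumptions

end Problem

/-! ### The parameters `τ_θ`, `σ_θ` and `κ_θ` -/

section Parameters

theorem tau_le_half (θ : ℝ) : tau θ ≤ 1 / 2 := by
  unfold tau
  split_ifs with h
  · rw [div_le_div_iff₀ (by linarith) (by norm_num)]
    linarith
  · exact le_rfl

/-- The two branches of `τ_θ` meet at `θ = 16/19`, where `τ_θ = 1/2` and the bound is an equality.
-/
theorem mul_tau_le {θ : ℝ} (h0 : 0 < θ) : (1 - θ) / θ * tau θ ≤ 3 / 32 := by
  unfold tau
  split_ifs with h
  · have h2 : 0 < 16 - 17 * θ := by linarith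
    have e : (1 - θ) / θ * (θ / (16 - 17 * θ)) = (1 - θ) / (16 - 17 * θ) := by field_simp
    rw [e, div_le_div_iff₀ h2 (by norm_num)]
    linarith
  · rw [div_mul_eq_mul_div, div_le_div_iff₀ h0 (by norm_num)]
    linarith

theorem sigma_poly_bound {θ σ : ℝ} (h0 : 0 < θ) (h1 : θ ≤ 1) (hσ : 0 ≤ σ)
    (hσ' : σ ≤ sigmaTheta θ) :
    3 / 4 * σ ^ 2 + 6 * ((1 - θ) / θ) * σ ^ 2 + 2 * ((1 - θ) / θ / tau θ) * σ ^ 2 + σ / 2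
      + 4 * ((1 - θ) / θ) * σ ≤ 1 / 8 := by
  have hτ := tau_pos h0
  have h := ((sigmaTheta_spec h0 h1 (sigmaTheta θ)).2 rfl).2
  unfold sigmaPoly at h
  have hB : 0 ≤ (1 - θ) / θ := div_nonneg (by linarith) h0.le
  have hy : 0 ≤ (1 - θ) / θ / tau θ := div_nonneg hB hτ.le
  have e1 : 2 * (1 - θ) * (3 * tau θ + 1) / (θ * tau θ)
      = 6 * ((1 - θ) / θ) + 2 * ((1 - θ) / θ / tau θ) := by field_simp; ring
  have e2 : (8 - 7 * θ) / (2 * θ) = 1 / 2 + 4 * ((1 - θ) / θ) := by field_simp; ring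
  rw [e1, e2] at h
  generalize (1 - θ) / θ / tau θ = y at *
  generalize (1 - θ) / θ = B at *
  have h2 : (3 / 4 + (6 * B + 2 * y)) * σ ^ 2 ≤ (3 / 4 + (6 * B + 2 * y)) * sigmaTheta θ ^ 2 := by
    gcongr
  have h3 : (1 / 2 + 4 * B) * σ ≤ (1 / 2 + 4 * B) * sigmaTheta θ := by gcongr
  linarith

/-- The descent coefficient of the potential, compared with `κ_θ`. -/
theorem descent_coefficient {θ σ : ℝ} (h0 : 0 < θ) (h1 : θ ≤ 1) (hσ : 0 ≤ σ)
    (hσ' : σ ≤ sigmaTheta θ) :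
    σ ≤ 1 / 4 ∧
    0 < 1 / 2 - (16 / 15 * σ) ^ 2 - (1 - θ) / θ * (2 * tau θ * (1 + 16 / 15 * σ) ^ 2
      + 2 * (16 / 15 * σ) * (1 + 16 / 15 * σ) + (16 / 15 * σ) ^ 2 / tau θ) ∧
    1 + 2 * ((1 - θ) / θ) ≤ 3 * kappa θ *
      (1 / 2 - (16 / 15 * σ) ^ 2 - (1 - θ) / θ * (2 * tau θ * (1 + 16 / 15 * σ) ^ 2
      + 2 * (16 / 15 * σ) * (1 + 16 / 15 * σ) + (16 / 15 * σ) ^ 2 / tau θ)) ∧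
    1 + 2 * ((1 - θ) / θ) ≤ kappa θ := by
  have hp := sigma_poly_bound h0 h1 hσ hσ'
  have hτ := tau_pos h0
  have hτ2 := tau_le_half θ
  have hBτ := mul_tau_le h0
  have hB : 0 ≤ (1 - θ) / θ := div_nonneg (by linarith) h0.le
  have hκ : kappa θ = 1 + 16 * ((1 - θ) / θ / tau θ) := by
    unfold kappa
    congr 1
    field_simp
  rw [hκ]
  have hBy : 2 * ((1 - θ) / θ) ≤ (1 - θ) / θ / tau θ := by
    rw [le_div_iff₀ hτ]
    have := mul_le_mul_of_nonneg_left hτ2 hB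
    linarith
  set s := 16 / 15 * σ with hs_def
  have hmul : (1 - θ) / θ * (2 * tau θ * (1 + s) ^ 2 + 2 * s * (1 + s) + s ^ 2 / tau θ)
      = 2 * ((1 - θ) / θ * tau θ) * (1 + s) ^ 2 + 2 * ((1 - θ) / θ) * s * (1 + s)
        + (1 - θ) / θ / tau θ * s ^ 2 := by ring
  rw [hmul]
  have hxB : (1 - θ) / θ * tau θ ≤ (1 - θ) / θ / 2 := by
    have := mul_le_mul_of_nonneg_left hτ2 hB
    linarith
  have hx0 : 0 ≤ (1 - θ) / θ * tau θ := mul_nonneg hB hτ.le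
  generalize (1 - θ) / θ * tau θ = x at *
  generalize (1 - θ) / θ / tau θ = y at *
  generalize (1 - θ) / θ = B at *
  have hy : 0 ≤ y := by linarith
  have hσ2 := sq_nonneg σ
  have hBσ := mul_nonneg hB hσ
  have hBσ2 := mul_nonneg hB hσ2
  have hyσ2 := mul_nonneg hy hσ2
  have hσ4 : σ ≤ 1 / 4 := by linarith
  have hs0 : 0 ≤ s := by positivity
  have hs4 : s ≤ 4 / 15 := by linarith
  have hσs : σ = 15 / 16 * s := by rw [hs_def]; ring
  rw [hσs] at hp
  have hBs := mul_nonneg hB hs0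
  have hs2 : s ^ 2 ≤ 4 / 15 * s := by nlinarith
  have hBs2 := mul_nonneg hB (sq_nonneg s)
  have hys2 := mul_nonneg hy (sq_nonneg s)
  have hmain : s ^ 2 + 4 * (B * s) + 3 * (B * s ^ 2) + y * s ^ 2 ≤ 1 / 7 := by
    linarith
  have hxs : x * s ≤ B / 2 * s := by gcongr
  have hxs2 : x * s ^ 2 ≤ B / 2 * s ^ 2 := by gcongr
  -- All terms containing `s` are bounded by `1/7` through `hmain`, and `5/14 = 1/2 - 1/7`.
  have hγ : 5 / 14 - 2 * x ≤ 1 / 2 - s ^ 2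
      - (2 * x * (1 + s) ^ 2 + 2 * B * s * (1 + s) + y * s ^ 2) := by linarith
  refine ⟨hσ4, by linarith, ?_, by linarith⟩
  have hκ0 : 0 ≤ 3 * (1 + 16 * y) := by positivity
  refine le_trans ?_ (mul_le_mul_of_nonneg_left hγ hκ0)
  have h5 : 3 * (1 + 32 * B) * (5 / 14 - 2 * x) ≤ 3 * (1 + 16 * y) * (5 / 14 - 2 * x) :=
    mul_le_mul_of_nonneg_right (by linarith) (by linarith)
  refine le_trans ?_ h5
  have hB0 : 0 ≤ 3 * (1 + 32 * B) := by positivity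
  -- There are two bounds for `2 x`, namely `B` and `3/16`; the better one is used on each side of
  -- their crossing.
  rcases le_total B (3 / 16) with hB' | hB'
  · have h6 : 3 * (1 + 32 * B) * (5 / 14 - B) ≤ 3 * (1 + 32 * B) * (5 / 14 - 2 * x) :=
      mul_le_mul_of_nonneg_left (by linarith) hB0
    have h7 : B * B ≤ 3 / 16 * B := mul_le_mul_of_nonneg_right hB' hB
    linarith
  · have h6 : 3 * (1 + 32 * B) * (5 / 14 - 3 / 16) ≤ 3 * (1 + 32 * B) * (5 / 14 - 2 * x) :=
      mul_le_mul_of_nonneg_left (by linarith) hB0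
    linarith

end Parameters

/-! ### Normal vectors and the distance to the boundary -/

section NormalCone

variable {E : Type*} [NormedAddCommGroup E] [InnerProductSpace ℝ E]

/-- The ball misses the frontier, so the interior of `C` and the complement of its closure would
disconnect it. -/
theorem ball_infDist_frontier_subset {C : Set E} {x : E} (hx : x ∈ C) :
    Metric.ball x (Metric.infDist x (frontier C)) ⊆ C := by
  intro y hy
  by_contra hyC
  have hpos : 0 < Metric.infDist x (frontier C) := Metric.pos_of_mem_ball hy
  have hpre : IsPreconnected (Metric.ball x (Metric.infDist x (frontier C))) :=
    (convex_ball _ _).isPreconnected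
  have hno : ∀ w ∈ Metric.ball x (Metric.infDist x (frontier C)),
      w ∈ closure C → w ∈ interior C := by
    intro w hw hwC
    by_contra hwi
    have := Metric.infDist_le_dist_of_mem (x := x) (show w ∈ frontier C from ⟨hwC, hwi⟩)
    rw [Metric.mem_ball, dist_comm] at hw
    linarith
  have hxb := Metric.mem_ball_self (x := x) hpos
  obtain ⟨w, -, hwi, hwc⟩ := hpre (interior C) (closure C)ᶜ isOpen_interior
    isClosed_closure.isOpen_compl (fun w hw => or_iff_not_imp_right.2 fun h =>
      hno w hw (not_not.1 h))
    ⟨x, hxb, hno x hxb (subset_closure hx)⟩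
    ⟨y, hy, fun h => hyC (interior_subset (hno y hy h))⟩
  exact hwc (subset_closure (interior_subset hwi))

/-- Normal vectors are controlled by the distance of an interior point to the boundary. -/
theorem norm_le_of_mem_normalCone [CompleteSpace E] {C : Set E} {zbar x ν : E} {Q : ℝ}
    (hz : zbar ∈ interior C) (hν : ν ∈ normalCone C x) (hQ : ⟪ν, x - zbar⟫_ℝ ≤ Q) :
    ‖ν‖ ≤ Q / Metric.infDist zbar (frontier C) := by
  have hle : ∀ u, zbar + u ∈ C → ⟪ν, u⟫_ℝ ≤ Q := by
    intro u hu
    have h1 := hν _ hu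
    have e : zbar + u - x = u - (x - zbar) := by abel
    rw [e, inner_sub_right] at h1
    linarith
  have hQ0 : 0 ≤ Q := by
    simpa using hle 0 (by simpa using interior_subset hz)
  rcases (frontier C).eq_empty_or_nonempty with hemp | hne
  · have huniv : C = univ := by
      rcases frontier_eq_empty_iff.1 hemp with h | h
      · rw [h] at hz
        simp at hz
      · exact h
    -- With an empty frontier the claim becomes `ν = 0`, which holds because every multiple of `ν`
    -- is an admissible test direction.
    rw [hemp, Metric.infDist_empty, div_zero]
    by_contra hpos
    push Not at hpos
    have h1 := hle (((Q + 1) / ‖ν‖ ^ 2) • ν) (by rw [huniv]; trivial)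
    rw [inner_smul_right, real_inner_self_eq_norm_sq, div_mul_cancel₀ _ (by positivity)] at h1
    linarith
  · have hd : 0 < Metric.infDist zbar (frontier C) := by
      rw [← isClosed_frontier.notMem_iff_infDist_pos hne]
      exact fun h => h.2 hz
    rw [le_div_iff₀ hd, mul_comm]
    rcases eq_or_ne ν 0 with rfl | hν0
    · simpa using hQ0
    have hν' : 0 < ‖ν‖ := norm_pos_iff.2 hν0
    rw [← le_div_iff₀ hν']
    -- Only the open ball is known to lie in `C`, so `ν` is tested along steps of length `t` below
    -- the distance.
    refine le_of_forall_lt_imp_le_of_dense fun t ht => ?_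
    rcases le_or_gt t 0 with ht0 | ht0
    · exact ht0.trans (div_nonneg hQ0 hν'.le)
    rw [le_div_iff₀ hν']
    have h1 := hle ((t / ‖ν‖) • ν) (ball_infDist_frontier_subset (interior_subset hz) (by
      rw [Metric.mem_ball, dist_self_add_left, norm_smul, Real.norm_of_nonneg (by positivity),
        div_mul_cancel₀ _ hν'.ne']
      exact ht))
    rw [inner_smul_right, real_inner_self_eq_norm_sq] at h1
    calc t * ‖ν‖ = t / ‖ν‖ * ‖ν‖ ^ 2 := by field_simp
      _ ≤ Q := h1

end NormalCone

/-! ### Spectrum of `A* A` and bounds for multipliers -/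

namespace Problem

variable {n l : ℕ} (P : Problem n l)

/-- The operator `A* A`. -/
def gram : Module.End ℝ (EuclideanSpace ℝ (Fin n)) :=
  ((ContinuousLinearMap.adjoint P.A ∘L P.A :
      EuclideanSpace ℝ (Fin n) →L[ℝ] EuclideanSpace ℝ (Fin n)) :
      Module.End ℝ (EuclideanSpace ℝ (Fin n)))

theorem gram_apply (u : EuclideanSpace ℝ (Fin n)) :
    P.gram u = ContinuousLinearMap.adjoint P.A (P.A u) := rfl

theorem inner_gram (u w : EuclideanSpace ℝ (Fin n)) : ⟪P.gram u, w⟫_ℝ = ⟪P.A u, P.A w⟫_ℝ := by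
  rw [gram_apply, ContinuousLinearMap.adjoint_inner_left]

theorem gram_isSymmetric : P.gram.IsSymmetric := by
  intro u w
  rw [inner_gram, real_inner_comm, ← inner_gram, real_inner_comm]

theorem gram_eigenvalue_nonneg {μ : ℝ} (h : Module.End.HasEigenvalue P.gram μ) : 0 ≤ μ := by
  refine eigenvalue_nonneg_of_nonneg h fun x => ?_
  rw [real_inner_comm, inner_gram, RCLike.re_to_real]
  exact real_inner_self_nonneg

theorem finrank_eq (n : ℕ) : Module.finrank ℝ (EuclideanSpace ℝ (Fin n)) = n := by simp

theorem hasEigenvalue_gram (i : Fin n) :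
    Module.End.HasEigenvalue P.gram (P.gram_isSymmetric.eigenvalues (finrank_eq n) i) := by
  simpa using P.gram_isSymmetric.hasEigenvalue_eigenvalues (finrank_eq n) i

theorem norm_map_sq_eq_sum (u : EuclideanSpace ℝ (Fin n)) :
    ‖P.A u‖ ^ 2 = ∑ i, P.gram_isSymmetric.eigenvalues (finrank_eq n) i
      * ((P.gram_isSymmetric.eigenvectorBasis (finrank_eq n)).repr u i) ^ 2 := by
  rw [← real_inner_self_eq_norm_sq, ← inner_gram,
    ← (P.gram_isSymmetric.eigenvectorBasis (finrank_eq n)).repr.inner_map_map]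
  simp only [PiLp.inner_apply, LinearMap.IsSymmetric.eigenvectorBasis_apply_self_apply]
  refine Finset.sum_congr rfl fun i _ => ?_
  simp
  ring

theorem norm_gram_sq_eq_sum (u : EuclideanSpace ℝ (Fin n)) :
    ‖ContinuousLinearMap.adjoint P.A (P.A u)‖ ^ 2
      = ∑ i, (P.gram_isSymmetric.eigenvalues (finrank_eq n) i) ^ 2
      * ((P.gram_isSymmetric.eigenvectorBasis (finrank_eq n)).repr u i) ^ 2 := by
  rw [← gram_apply, ← (P.gram_isSymmetric.eigenvectorBasis (finrank_eq n)).repr.norm_map,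
    EuclideanSpace.norm_sq_eq]
  simp only [LinearMap.IsSymmetric.eigenvectorBasis_apply_self_apply]
  refine Finset.sum_congr rfl fun i _ => ?_
  simp [mul_pow]

theorem sigmaPlus_le {μ : ℝ} (hμ : 0 < μ) (h : Module.End.HasEigenvalue P.gram μ) :
    P.sigmaPlus ≤ √μ := by
  refine csInf_le ⟨0, fun s hs => hs.1.le⟩ ⟨Real.sqrt_pos.2 hμ, ?_⟩
  rw [Real.sq_sqrt hμ.le]
  exact h

/-- There are finitely many eigenvalues, so the infimum is attained; if none were positive, the
spectral expansion would give `A = 0`. -/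
theorem sigmaPlus_pos (hA : P.A ≠ 0) : 0 < P.sigmaPlus := by
  have hfin : {s : ℝ | 0 < s ∧ Module.End.HasEigenvalue P.gram (s ^ 2)}.Finite := by
    refine Set.Finite.of_finite_image (f := fun s : ℝ => s ^ 2)
      ((Module.End.finite_hasEigenvalue P.gram).subset ?_) ?_
    · rintro _ ⟨s, hs, rfl⟩
      exact hs.2
    · intro s hs t ht hst
      exact (pow_left_inj₀ hs.1.le ht.1.le two_ne_zero).1 hst
  have hne : {s : ℝ | 0 < s ∧ Module.End.HasEigenvalue P.gram (s ^ 2)}.Nonempty := by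
    by_contra hemp
    rw [Set.not_nonempty_iff_eq_empty] at hemp
    refine hA (ContinuousLinearMap.ext fun u => ?_)
    have h0 : ∀ i, P.gram_isSymmetric.eigenvalues (finrank_eq n) i = 0 := by
      intro i
      have hev := P.hasEigenvalue_gram i
      rcases (P.gram_eigenvalue_nonneg hev).eq_or_lt with h | h
      · exact h.symm
      · exfalso
        have : √(P.gram_isSymmetric.eigenvalues (finrank_eq n) i)
            ∈ {s : ℝ | 0 < s ∧ Module.End.HasEigenvalue P.gram (s ^ 2)} := by
          refine ⟨Real.sqrt_pos.2 h, ?_⟩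
          rw [Real.sq_sqrt h.le]
          exact hev
        rw [hemp] at this
        exact this
    have h1 := P.norm_map_sq_eq_sum u
    simp only [h0, zero_mul, Finset.sum_const_zero] at h1
    simpa using h1
  exact (hne.csInf_mem hfin).1

/-- For `q = A u` an eigenvalue `μ` contributes `μ` to `‖q‖²` and `μ²` to `‖A* q‖²`, with the same
weight. Zero eigenvalues drop out of both, which is why `q` must lie in the range. -/
theorem sigmaPlus_mul_norm_le {q : EuclideanSpace ℝ (Fin l)} (hq : q ∈ range P.A)
    (hσ : 0 ≤ P.sigmaPlus) :
    P.sigmaPlus * ‖q‖ ≤ ‖ContinuousLinearMap.adjoint P.A q‖ := by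
  obtain ⟨u, rfl⟩ := hq
  refine abs_le_of_sq_le_sq' ?_ (norm_nonneg _) |>.2
  rw [mul_pow, norm_map_sq_eq_sum, norm_gram_sq_eq_sum, Finset.mul_sum]
  refine Finset.sum_le_sum fun i _ => ?_
  have hev := P.hasEigenvalue_gram i
  rcases (P.gram_eigenvalue_nonneg hev).eq_or_lt with h | h
  · rw [← h]
    simp
  · have h1 : P.sigmaPlus ^ 2 ≤ P.gram_isSymmetric.eigenvalues (finrank_eq n) i := by
      calc P.sigmaPlus ^ 2 ≤ √(P.gram_isSymmetric.eigenvalues (finrank_eq n) i) ^ 2 := by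
            have := P.sigmaPlus_le h hev
            gcongr
        _ = _ := Real.sq_sqrt h.le
    rw [← mul_assoc, sq (P.gram_isSymmetric.eigenvalues (finrank_eq n) i)]
    gcongr

variable {P} {θ c : ℝ}

/-- A multiplier that exceeds its decayed predecessor is bounded through the Slater point. -/
theorem sigmaPlus_mul_norm_multiplier_le {zbar x w ξ s : EuclideanSpace ℝ (Fin n)}
    {p₀ p : EuclideanSpace ℝ (Fin l)} {G S' D' : ℝ} (hσ : 0 ≤ P.sigmaPlus)
    (hzbar : zbar ∈ interior (dom P.h)) (hzb : P.A zbar = P.b) (hc : 0 < c)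
    (hw : w = P.gradf x + ξ + ContinuousLinearMap.adjoint P.A p)
    (hs : ‖s‖ ≤ S') (hξ : ξ - s ∈ normalCone (dom P.h) x)
    (hp : p = (1 - θ) • p₀ + c • (P.A x - P.b)) (hpr : p ∈ range P.A)
    (hlt : ‖(1 - θ) • p₀‖ ≤ ‖p‖) (hD : ‖x - zbar‖ ≤ D') (hG : ‖w‖ + ‖P.gradf x‖ ≤ G) :
    P.sigmaPlus * ‖p‖ ≤ (1 + D' / Metric.infDist zbar (frontier (dom P.h))) * (G + S') := by
  have hQ : ‖w - P.gradf x - s‖ ≤ G + S' := by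
    refine (norm_sub_le _ _).trans (add_le_add ((norm_sub_le _ _).trans hG) hs)
  have hν : ξ - s = (w - P.gradf x - s) - ContinuousLinearMap.adjoint P.A p := by
    rw [hw]; abel
  have hfeas : 0 ≤ ⟪p, P.A x - P.b⟫_ℝ := by
    have e : c * ⟪p, P.A x - P.b⟫_ℝ = ‖p‖ ^ 2 - ⟪p, (1 - θ) • p₀⟫_ℝ := by
      rw [← inner_smul_right, ← real_inner_self_eq_norm_sq, ← inner_sub_right]
      congr 1
      exact eq_sub_of_add_eq' hp.symm
    have h1 := real_inner_le_norm p ((1 - θ) • p₀)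
    have h2 := mul_le_mul_of_nonneg_left hlt (norm_nonneg p)
    refine le_of_mul_le_mul_left ?_ hc
    rw [mul_zero, e, sq]
    linarith
  have hinner : ⟪ξ - s, x - zbar⟫_ℝ ≤ (G + S') * D' := by
    rw [hν, inner_sub_left, ContinuousLinearMap.adjoint_inner_left, map_sub, hzb]
    have h1 := real_inner_le_norm (w - P.gradf x - s) (x - zbar)
    have h2 : ‖w - P.gradf x - s‖ * ‖x - zbar‖ ≤ (G + S') * D' := by
      have : 0 ≤ G + S' := (norm_nonneg _).trans hQ
      gcongr
    linarith
  have h3 := norm_le_of_mem_normalCone hzbar hξ hinner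
  have h4 := P.sigmaPlus_mul_norm_le hpr hσ
  have e : ContinuousLinearMap.adjoint P.A p = (w - P.gradf x - s) - (ξ - s) := by
    rw [hw]; abel
  calc _ ≤ ‖ContinuousLinearMap.adjoint P.A p‖ := h4
    _ ≤ ‖w - P.gradf x - s‖ + ‖ξ - s‖ := by rw [e]; exact norm_sub_le _ _
    _ ≤ (G + S') + (G + S') * D' / Metric.infDist zbar (frontier (dom P.h)) := add_le_add hQ h3
    _ = _ := by ring

end Problem

/-- Lets a bound valid for every admissible `s` pass to the infimum `S(α)`, which need not be
attained. -/
theorem le_mul_add_sInf {T : Set ℝ} (hT : T.Nonempty) {X W G : ℝ} (hW : 0 < W)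
    (h : ∀ s ∈ T, X ≤ W * (G + s)) : X ≤ W * (G + sInf T) := by
  have h1 : X / W - G ≤ sInf T := le_csInf hT fun s hs => by
    have := h s hs
    rw [sub_le_iff_le_add, div_le_iff₀ hW]
    linarith
  rw [sub_le_iff_le_add, div_le_iff₀ hW] at h1
  linarith

/-! ### Sublevel sets, `R₀` and the run estimate -/

namespace Problem

variable {n l : ℕ} {P : Problem n l} {L m cbar θ c lam : ℝ}
  {zbar z₀ : EuclideanSpace ℝ (Fin n)}

/-- The penalized objective as a real-valued function on `dom h`. -/
def penObj (P : Problem n l) (cbar : ℝ) (z : EuclideanSpace ℝ (Fin n)) : ℝ :=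
  P.obj z + cbar / 2 * ‖P.A z - P.b‖ ^ 2

namespace BasicAssumptions

theorem phi_eq (hA : P.BasicAssumptions L m cbar) {z : EuclideanSpace ℝ (Fin n)}
    (hz : z ∈ dom P.h) : P.phi cbar z = ((P.penObj cbar z : ℝ) : EReal) := by
  unfold phi penObj obj
  rw [← coe_toReal_of_mem_dom hA.h_closed_proper_convex.ne_bot hz, EReal.toReal_coe]
  push_cast
  rfl

theorem phiStar_le (hA : P.BasicAssumptions L m cbar) {z : EuclideanSpace ℝ (Fin n)}
    (hz : z ∈ dom P.h) : (P.phiStar cbar).toReal ≤ P.penObj cbar z := by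
  have h1 : P.phiStar cbar ≤ ((P.penObj cbar z : ℝ) : EReal) := by
    rw [← hA.phi_eq hz]
    exact iInf_le _ z
  rw [← EReal.coe_toReal (h1.trans_lt (EReal.coe_lt_top _)).ne hA.phiStar_gt_bot.ne'] at h1
  exact EReal.coe_le_coe_iff.1 h1

theorem R0_term_nonneg (hA : P.BasicAssumptions L m cbar) (hlam : 0 < lam)
    {z : EuclideanSpace ℝ (Fin n)} (hz : z ∈ P.feasible) :
    0 ≤ lam * (P.f z + (P.h z).toReal - (P.phiStar cbar).toReal) + ‖z - z₀‖ ^ 2 := by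
  have h1 := hA.phiStar_le hz.1
  unfold penObj obj at h1
  rw [hz.2, sub_self, norm_zero, zero_pow two_ne_zero, mul_zero, add_zero] at h1
  have := mul_nonneg hlam.le (sub_nonneg.2 h1)
  positivity

theorem R0_nonneg (hA : P.BasicAssumptions L m cbar) (hlam : 0 < lam) :
    0 ≤ P.R0 lam cbar z₀ := by
  refine Real.sInf_nonneg ?_
  rintro _ ⟨z, hz, rfl⟩
  exact hA.R0_term_nonneg hlam hz

theorem le_R0 (hA : P.BasicAssumptions L m cbar) {X : ℝ}
    (h : ∀ w ∈ dom P.h, P.A w = P.b →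
      X ≤ lam * (P.obj w - (P.phiStar cbar).toReal) + ‖w - z₀‖ ^ 2) :
    X ≤ P.R0 lam cbar z₀ := by
  refine le_csInf (hA.feasible_nonempty.image _) ?_
  rintro _ ⟨z, hz, rfl⟩
  exact h z hz.1 hz.2

/-- The estimate for a run of inexact steps, in terms of the constants of the method. -/
theorem run_estimate (hA : P.BasicAssumptions L m cbar) (hθ : 0 < θ) (hθ1 : θ ≤ 1)
    (hc : 2 * cbar < c) {σ : ℝ} (hσ : 0 ≤ σ) (hσ' : σ ≤ sigmaTheta θ)
    {p : ℕ → EuclideanSpace ℝ (Fin l)} {z v : ℕ → EuclideanSpace ℝ (Fin n)} {ε : ℕ → ℝ} {N : ℕ}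
    (hp0 : p 0 = 0)
    (hp : ∀ k < N + 1, p (k + 1) = (1 - θ) • p k + c • (P.A (z (k + 1)) - P.b))
    (hstep : ∀ k < N + 1, InexactStep P.obj (dom P.h) P.A P.b (tau θ / m) θ c (16 / 15 * σ)
      (p k) (z k) (z (k + 1)) (v (k + 1)) (ε (k + 1))) :
    tau θ / m * (P.penObj cbar (z (N + 1)) - (P.phiStar cbar).toReal)
        ≤ kappa θ * P.R0 (tau θ / m) cbar (z 0) ∧
      ∑ k ∈ Finset.range (N + 1), ‖v (k + 1) + z k - z (k + 1)‖ ^ 2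
        ≤ 3 * kappa θ * P.R0 (tau θ / m) cbar (z 0) := by
  have hτ := tau_pos hθ
  have hlam : 0 < tau θ / m := div_pos hτ hA.m_pos
  obtain ⟨h4, hγ, hκγ, hκ⟩ := descent_coefficient hθ hθ1 hσ hσ'
  have hB : 0 ≤ (1 - θ) / θ := div_nonneg (by linarith) hθ.le
  have hc0 : 0 < c := by linarith [hA.cbar_nonneg]
  have hest := inexact_run_estimate (cbar := cbar) (Φ := (P.phiStar cbar).toReal)
    hA.weaklyConvexOn_obj hlam hA.convex_dom hc0 hc.le hB
    (div_mul_cancel₀ _ hθ.ne') hτ (tau_le_half θ) (div_mul_cancel₀ _ hA.m_pos.ne')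
    (by positivity) (by linarith) (fun w hw => hA.phiStar_le hw) (fun X hX => hA.le_R0 hX)
    hp0 hp hstep
  have hR : 0 ≤ P.R0 (tau θ / m) cbar (z 0) := hA.R0_nonneg hlam
  have hdom : z (N + 1) ∈ dom P.h := (hstep N (by omega)).mem
  have hpen : 0 ≤ tau θ / m * (P.penObj cbar (z (N + 1)) - (P.phiStar cbar).toReal) :=
    mul_nonneg hlam.le (sub_nonneg.2 (hA.phiStar_le hdom))
  have hsum : 0 ≤ ∑ k ∈ Finset.range (N + 1), ‖v (k + 1) + z k - z (k + 1)‖ ^ 2 :=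
    Finset.sum_nonneg fun _ _ => sq_nonneg _
  unfold penObj at hpen ⊢
  generalize 1 / 2 - (16 / 15 * σ) ^ 2 - (1 - θ) / θ * (2 * tau θ * (1 + 16 / 15 * σ) ^ 2
      + 2 * (16 / 15 * σ) * (1 + 16 / 15 * σ) + (16 / 15 * σ) ^ 2 / tau θ) = γ at *
  generalize ∑ k ∈ Finset.range (N + 1), ‖v (k + 1) + z k - z (k + 1)‖ ^ 2 = T at *
  have h1 := mul_le_mul_of_nonneg_right hκ hR
  have h2 := mul_le_mul_of_nonneg_right hκγ hR
  have h3 := mul_nonneg hγ.le hsum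
  refine ⟨by linarith, le_of_mul_le_mul_left ?_ hγ⟩
  linarith

/-- The level is expressed without `φ*_cbar`; this is legitimate because `φ*_cbar ≤ φ_cbar(zbar)`.
-/
theorem mem_sublevel_level (hA : P.BasicAssumptions L m cbar) (hlam : 0 < lam)
    (hzbar : zbar ∈ dom P.h) {z : EuclideanSpace ℝ (Fin n)} (hz : z ∈ dom P.h)
    (h : lam * (P.penObj cbar z - (P.phiStar cbar).toReal) ≤ kappa θ * P.R0 lam cbar z₀) :
    z ∈ sublevel (P.phi cbar) (P.level θ lam cbar zbar z₀) := by
  change P.phi cbar z ≤ _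
  rw [hA.phi_eq hz, EReal.coe_le_coe_iff]
  unfold level
  have h1 := hA.phiStar_le hzbar
  have h2 : P.penObj cbar z - (P.phiStar cbar).toReal ≤ kappa θ * P.R0 lam cbar z₀ / lam := by
    rw [le_div_iff₀ hlam]
    linarith
  have h3 := le_max_right (P.phi cbar z₀).toReal (P.phi cbar zbar).toReal
  rw [hA.phi_eq hzbar, EReal.toReal_coe] at h3 ⊢
  linarith

theorem max_mem_sublevel_level (hA : P.BasicAssumptions L m cbar) (hlam : 0 < lam)
    (hκ : 0 ≤ kappa θ) (hzbar : zbar ∈ dom P.h) (hz₀ : z₀ ∈ dom P.h) :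
    z₀ ∈ sublevel (P.phi cbar) (P.level θ lam cbar zbar z₀) ∧
      zbar ∈ sublevel (P.phi cbar) (P.level θ lam cbar zbar z₀) := by
  have h1 : 0 ≤ kappa θ * P.R0 lam cbar z₀ / lam :=
    div_nonneg (mul_nonneg hκ (hA.R0_nonneg hlam)) hlam.le
  have h2 := le_max_right (P.phi cbar z₀).toReal (P.phi cbar zbar).toReal
  have h3 := le_max_left (P.phi cbar z₀).toReal (P.phi cbar zbar).toReal
  constructor
  · change P.phi cbar z₀ ≤ _
    rw [hA.phi_eq hz₀, EReal.coe_le_coe_iff]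
    unfold level
    rw [hA.phi_eq hz₀, EReal.toReal_coe] at h3 ⊢
    linarith
  · change P.phi cbar zbar ≤ _
    rw [hA.phi_eq hzbar, EReal.coe_le_coe_iff]
    unfold level
    rw [hA.phi_eq hzbar, EReal.toReal_coe] at h2 ⊢
    linarith

end BasicAssumptions

/-- The multipliers generated by the primal iterates `z`. -/
def multiplier (P : Problem n l) (θ c : ℝ) (z : ℕ → EuclideanSpace ℝ (Fin n)) :
    ℕ → EuclideanSpace ℝ (Fin l)
  | 0 => 0
  | k + 1 => (1 - θ) • P.multiplier θ c z k + c • (P.A (z (k + 1)) - P.b)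

theorem multiplier_congr {z z' : ℕ → EuclideanSpace ℝ (Fin n)} {k : ℕ}
    (h : ∀ i ≤ k, z i = z' i) : P.multiplier θ c z k = P.multiplier θ c z' k := by
  induction k with
  | zero => rfl
  | succ k ih =>
    simp only [multiplier]
    rw [ih fun i hi => h i (by omega), h (k + 1) le_rfl]

theorem multiplier_mem_range (hzb : P.A zbar = P.b) (z : ℕ → EuclideanSpace ℝ (Fin n)) (k : ℕ) :
    P.multiplier θ c z k ∈ range P.A := by
  induction k with
  | zero => exact ⟨0, by simp [multiplier]⟩
  | succ k ih =>
    obtain ⟨u, hu⟩ := ih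
    refine ⟨(1 - θ) • u + c • (z (k + 1) - zbar), ?_⟩
    simp only [multiplier, map_add, map_smul, map_sub, hu, hzb]

end Problem

/-- A discounted recursion driven by a square summable sequence. -/
theorem discounted_sum_bound {θ : ℝ} (h0 : 0 < θ) (h1 : θ ≤ 1) {β Q r : ℝ} (h : θ * β ^ 2 ≤ Q) :
    θ * ((1 - θ) * β + r) ^ 2 ≤ Q + r ^ 2 := by
  have e : θ * ((1 - θ) * β + r) ^ 2
      = (1 - θ) * (θ * β ^ 2) + r ^ 2 - (1 - θ) * (θ * β - r) ^ 2 := by ring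
  have h2 : 0 ≤ (1 - θ) * (θ * β - r) ^ 2 := mul_nonneg (by linarith) (sq_nonneg _)
  have h3 : 0 ≤ θ * (θ * β ^ 2) := by positivity
  rw [e]
  linarith

/-! ### Bounds for a single outer iteration -/

namespace Problem

variable {n l : ℕ} {P : Problem n l} {L m cbar θ c lam : ℝ}
  {zbar z₀ : EuclideanSpace ℝ (Fin n)}

/-- The bound on the multipliers of one outer iteration; the full constant `N0` adds the
accumulated differences between the multipliers at the iterates and at the refined points. -/
def stepBound (P : Problem n l) (L θ lam cbar : ℝ) (zbar z₀ : EuclideanSpace ℝ (Fin n)) : ℝ :=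
  (1 + max (√(3 * kappa θ * P.R0 lam cbar z₀)) (P.D cbar (P.level θ lam cbar zbar z₀)) /
      Metric.infDist zbar (frontier (dom P.h))) *
    (‖P.gradf z₀‖ + L * P.D cbar (P.level θ lam cbar zbar z₀)
      + 3 / lam * √(3 * kappa θ * P.R0 lam cbar z₀)
      + P.S cbar (P.level θ lam cbar zbar z₀))

namespace BasicAssumptions

theorem refined_multiplier_bound (hA : P.BasicAssumptions L m cbar)
    (hzbar : zbar ∈ interior (dom P.h)) (hzb : P.A zbar = P.b) (hc : 0 < c) (hlam : 0 < lam)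
    (hκ : 0 ≤ kappa θ) (hz₀ : z₀ ∈ dom P.h)
    (hB2 : ∀ α : ℝ, Bornology.IsBounded (sublevel (P.phi cbar) α))
    (hB3 : ∀ α : ℝ, (P.subdiffBounds cbar α).Nonempty)
    {p : EuclideanSpace ℝ (Fin l)} {zm z v zh vh : EuclideanSpace ℝ (Fin n)}
    (hp : p ∈ range P.A) (hz : z ∈ dom P.h)
    (hr : IsRefinement (P.smoothAL θ c p) P.h (P.Lc L c) lam zm z v zh vh)
    (hd : (lam * P.Lc L c + 1) * ‖zh - z‖ ≤ ‖v + zm - z‖)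
    (hq : ‖v + zm - z‖ ≤ √(3 * kappa θ * P.R0 lam cbar z₀))
    (hlev : zh ∈ sublevel (P.phi cbar) (P.level θ lam cbar zbar z₀))
    (hlt : ‖(1 - θ) • p‖ ≤ ‖(1 - θ) • p + c • (P.A zh - P.b)‖) :
    P.sigmaPlus * ‖(1 - θ) • p + c • (P.A zh - P.b)‖ ≤ P.stepBound L θ lam cbar zbar z₀ := by
  have hint : (interior (dom P.h)).Nonempty := ⟨zbar, hzbar⟩
  have hzbar' := interior_subset hzbar
  have hL : 0 < L := hA.m_pos.trans_le hA.m_le_L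
  obtain ⟨hzh, -⟩ := hA.refinement_optimality hint hlam hz hr
  obtain ⟨ξ, hξ, hvh⟩ := hA.refinement_subgradient hint hlam hz hr
  have hvn := hA.norm_refined_residual_le hint hc.le hlam hz hr hd
  obtain ⟨h0lev, hblev⟩ := hA.max_mem_sublevel_level hlam hκ hzbar' hz₀
  have hrange : (1 - θ) • p + c • (P.A zh - P.b) ∈ range P.A := by
    obtain ⟨u, rfl⟩ := hp
    exact ⟨(1 - θ) • u + c • (zh - zbar), by simp only [map_add, map_smul, map_sub, hzb]⟩
  set α := P.level θ lam cbar zbar z₀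
  set q := √(3 * kappa θ * P.R0 lam cbar z₀)
  have hD1 : ‖zh - zbar‖ ≤ max q (P.D cbar α) := by
    rw [← dist_eq_norm]
    exact (Metric.dist_le_diam_of_mem (hB2 α) hlev hblev).trans (le_max_right _ _)
  have hD2 : ‖zh - z₀‖ ≤ P.D cbar α := by
    rw [← dist_eq_norm]
    exact Metric.dist_le_diam_of_mem (hB2 α) hlev h0lev
  have hG : ‖vh‖ + ‖P.gradf zh‖ ≤ ‖P.gradf z₀‖ + L * P.D cbar α + 3 / lam * q := by
    have h1 := hA.grad_lipschitz z₀ hz₀ zh hzh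
    have h2 := norm_le_norm_add_norm_sub' (P.gradf zh) (P.gradf z₀)
    have h3 : L * ‖zh - z₀‖ ≤ L * P.D cbar α := by gcongr
    have h4 : 3 / lam * ‖v + zm - z‖ ≤ 3 / lam * q := by gcongr
    linarith
  have hW : 0 < 1 + max q (P.D cbar α) / Metric.infDist zbar (frontier (dom P.h)) := by
    have : 0 ≤ max q (P.D cbar α) / Metric.infDist zbar (frontier (dom P.h)) :=
      div_nonneg (le_max_of_le_left (Real.sqrt_nonneg _)) Metric.infDist_nonneg
    linarith
  refine le_mul_add_sInf (hB3 α) hW fun S' hS' => ?_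
  obtain ⟨s, hs, ν, hν, rfl⟩ := hS'.2 zh hlev hξ
  exact sigmaPlus_mul_norm_multiplier_le (s := s) (P.sigmaPlus_pos hA.A_ne_zero).le hzbar hzb hc
    hvh (by simpa using hs) (by simpa using hν) rfl hrange hlt hD1 hG

/-- Here `c` disappears: `c ‖A‖² ≤ L_c`, while `lam L_c ‖zh - z‖` is at most the residual. -/
theorem sigmaPlus_mul_refinement_gap_le (hA : P.BasicAssumptions L m cbar) (hc : 0 < c)
    (hlam : 0 < lam) {zm z v zh : EuclideanSpace ℝ (Fin n)}
    (hd : (lam * P.Lc L c + 1) * ‖zh - z‖ ≤ ‖v + zm - z‖) :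
    P.sigmaPlus * ‖c • P.A (z - zh)‖ ≤ ‖v + zm - z‖ / lam := by
  have hL : 0 < L := hA.m_pos.trans_le hA.m_le_L
  have h1 := P.sigmaPlus_mul_norm_le (q := c • P.A (z - zh))
    ⟨c • (z - zh), by rw [map_smul]⟩ (P.sigmaPlus_pos hA.A_ne_zero).le
  refine h1.trans ?_
  rw [map_smul, norm_smul, Real.norm_of_nonneg hc.le, le_div_iff₀ hlam]
  have h2 := mul_le_mul_of_nonneg_left (norm_adjoint_comp_le P (z - zh)) hc.le
  have h3 : P.Lc L c * ‖zh - z‖ = L * ‖zh - z‖ + c * (‖P.A‖ ^ 2 * ‖zh - z‖) := by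
    unfold Lc; ring
  rw [norm_sub_rev z zh] at h2
  have h4 : 0 ≤ L * ‖zh - z‖ := by positivity
  have h5 := mul_le_mul_of_nonneg_left (h2.trans (by linarith :
    c * (‖P.A‖ ^ 2 * ‖zh - z‖) ≤ P.Lc L c * ‖zh - z‖)) hlam.le
  linarith [norm_nonneg (zh - z)]

/-- The constant `N0` dominates the bound of a single step plus the accumulated error. -/
theorem stepBound_add_le (hA : P.BasicAssumptions L m cbar) (hθ : 0 < θ) (hθ1 : θ ≤ 1)
    (hlam : 0 < lam) {β : ℝ}
    (hβ : θ * β ^ 2 ≤ 3 * kappa θ * P.R0 lam cbar z₀) :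
    0 ≤ P.stepBound L θ lam cbar zbar z₀ ∧
    P.stepBound L θ lam cbar zbar z₀ + β / lam
      ≤ P.sigmaPlus * P.N0 L θ lam cbar zbar z₀ := by
  have hσ := P.sigmaPlus_pos hA.A_ne_zero
  have hL : 0 < L := hA.m_pos.trans_le hA.m_le_L
  have hS : 0 ≤ P.S cbar (P.level θ lam cbar zbar z₀) := by
    exact Real.sInf_nonneg fun s hs => hs.1
  have hD : 0 ≤ P.D cbar (P.level θ lam cbar zbar z₀) := Metric.diam_nonneg
  have hβ' : β ≤ 1 / √θ * √(3 * kappa θ * P.R0 lam cbar z₀) := by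
    rw [one_div, ← div_eq_inv_mul, le_div_iff₀ (Real.sqrt_pos.2 hθ)]
    refine Real.le_sqrt_of_sq_le ?_
    rw [mul_pow, Real.sq_sqrt hθ.le, mul_comm]
    exact hβ
  have hθ' : 1 ≤ 1 / √θ := by
    rw [one_le_div (Real.sqrt_pos.2 hθ)]
    exact Real.sqrt_le_one.2 hθ1
  have e : 14 / (lam * √θ) = 14 / lam * (1 / √θ) := by field_simp
  unfold stepBound N0
  rw [e, ← mul_assoc, ← mul_assoc, mul_one_div_cancel hσ.ne', one_mul]
  set q := √(3 * kappa θ * P.R0 lam cbar z₀)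
  have hq : 0 ≤ q := Real.sqrt_nonneg _
  set D' := P.D cbar (P.level θ lam cbar zbar z₀)
  have hW : 1 ≤ 1 + max q D' / Metric.infDist zbar (frontier (dom P.h)) := by
    have : 0 ≤ max q D' / Metric.infDist zbar (frontier (dom P.h)) :=
      div_nonneg (le_max_of_le_left hq) Metric.infDist_nonneg
    linarith
  generalize 1 + max q D' / Metric.infDist zbar (frontier (dom P.h)) = W at *
  generalize P.S cbar (P.level θ lam cbar zbar z₀) = S' at *
  have hg := norm_nonneg (P.gradf z₀)
  refine ⟨by positivity, ?_⟩
  have h1 : β / lam ≤ W * (1 / lam * (1 / √θ) * q) := by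
    calc β / lam = 1 / lam * β := by ring
      _ ≤ 1 / lam * (1 / √θ * q) := by gcongr
      _ = 1 * (1 / lam * (1 / √θ) * q) := by ring
      _ ≤ W * (1 / lam * (1 / √θ) * q) := by gcongr
  -- Only `4 / (lam √θ)` is needed, three parts for the refined residual and one for `β`; the
  -- constant `14` leaves room.
  have h2 : ‖P.gradf z₀‖ + L * D' + 3 / lam * q + S' + 1 / lam * (1 / √θ) * q
      ≤ ‖P.gradf z₀‖ + L * D' + S' + (L + 14 / lam * (1 / √θ)) * q := by
    have h3 : 1 / lam * q ≤ 1 / lam * (1 / √θ) * q := by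
      gcongr
      exact le_mul_of_one_le_right (by positivity) hθ'
    have h4 : 0 ≤ 1 / lam * (1 / √θ) * q := by positivity
    have h5 : 0 ≤ L * q := by positivity
    have e1 : 3 / lam * q = 3 * (1 / lam * q) := by ring
    have e2 : (L + 14 / lam * (1 / √θ)) * q = L * q + 14 * (1 / lam * (1 / √θ) * q) := by ring
    linarith
  have h3 := mul_le_mul_of_nonneg_left h2 (by linarith : 0 ≤ W)
  linarith

end BasicAssumptions

end Problem

end IPAAL

end

/-! ### The main theorem -/

theorem theorem3p2 {n l : ℕ} (P : IPAAL.Problem n l) (L m cbar θ : ℝ)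
    (zbar z₀ : EuclideanSpace ℝ (Fin n))
    (hA : P.BasicAssumptions L m cbar)
    (hθ : 0 < θ) (hθ1 : θ ≤ 1)
    (hz₀ : z₀ ∈ IPAAL.dom P.h)
    (hB1 : zbar ∈ interior (IPAAL.dom P.h) ∧ P.A zbar = P.b)
    (hB2 : ∀ α : ℝ, Bornology.IsBounded (IPAAL.sublevel (P.phi cbar) α))
    (hB3 : ∀ α : ℝ, (P.subdiffBounds cbar α).Nonempty)
    (c ρ : ℝ) (hc : 2 * cbar < c) (hρ : 0 < ρ)
    (zhat vhat : EuclideanSpace ℝ (Fin n)) (phat : EuclideanSpace ℝ (Fin l))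
    (hout : P.IsStaticOutput L m θ c ρ z₀ zhat vhat phat) :
    (∃ ξ ∈ IPAAL.subdiff P.h zhat,
      vhat = P.gradf zhat + ξ + ContinuousLinearMap.adjoint P.A phat) ∧
    ‖vhat‖ ≤ ρ ∧
    ‖P.A zhat - P.b‖ ≤ 2 * P.N0 L θ (IPAAL.tau θ / m) cbar zbar z₀ / c := by
  obtain ⟨hzbar, hzb⟩ := hB1
  obtain ⟨K, z, v, zh, vh, p, ph, ε, rfl, hp0, hsteps, hcont, hresid, rfl, rfl, rfl⟩ := hout
  have hint : (interior (IPAAL.dom P.h)).Nonempty := ⟨zbar, hzbar⟩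
  have hτ := IPAAL.tau_pos hθ
  have hlam : 0 < IPAAL.tau θ / m := div_pos hτ hA.m_pos
  have hlm : IPAAL.tau θ / m * m = IPAAL.tau θ := div_mul_cancel₀ _ hA.m_pos.ne'
  have hc0 : 0 < c := by linarith [hA.cbar_nonneg]
  set lam := IPAAL.tau θ / m
  set σ := P.sigma L θ lam c with hσ_def
  have hσθ : 0 < IPAAL.sigmaTheta θ := ((IPAAL.sigmaTheta_spec hθ hθ1 _).2 rfl).1
  have hσ0 : 0 ≤ σ := le_min (by positivity) hσθ.le
  have hσ1 : σ ≤ 1 / √(lam * P.Lc L c + 1) := min_le_left _ _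
  have hσ2 : σ ≤ IPAAL.sigmaTheta θ := min_le_right _ _
  obtain ⟨hσ4, -, -, hκ1⟩ := IPAAL.descent_coefficient hθ hθ1 hσ0 hσ2
  have hκ : 0 ≤ IPAAL.kappa θ := by
    have : 0 ≤ (1 - θ) / θ := div_nonneg (by linarith) hθ.le
    linarith
  have hst : ∀ k < K + 1, IPAAL.InexactStep P.obj (IPAAL.dom P.h) P.A P.b lam θ c σ
      (p k) (z k) (z (k + 1)) (v (k + 1)) (ε (k + 1)) := by
    intro k
    induction k with
    | zero =>
      intro hk
      exact hA.inexactStep hint hc0.le hlam hlm ((IPAAL.tau_le_half θ).trans (by norm_num)) hz₀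
        (hsteps 0 hk).1
    | succ k ih =>
      intro hk
      exact hA.inexactStep hint hc0.le hlam hlm ((IPAAL.tau_le_half θ).trans (by norm_num))
        (ih (by omega)).mem (hsteps (k + 1) hk).1
  -- The method does not set `p (K + 1)`; `multiplier` supplies a value, so the run estimate also
  -- covers the last iteration.
  have hpm : ∀ k < K + 1, p k = P.multiplier θ c z k := by
    intro k
    induction k with
    | zero => intro _; exact hp0
    | succ k ih =>
      intro hk
      rw [(hcont k (by omega)).2, ih (by omega)]
      rfl
  -- All steps are relaxed to the error `16/15 σ` of the refined point, so that a mixed run has one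
  -- common tolerance.
  have hmono : ∀ k < K + 1, IPAAL.InexactStep P.obj (IPAAL.dom P.h) P.A P.b lam θ c (16 / 15 * σ)
      (P.multiplier θ c z k) (z k) (z (k + 1)) (v (k + 1)) (ε (k + 1)) := fun k hk =>
    hpm k hk ▸ (hst k hk).mono hσ0 (by linarith)
  have hQ := (hA.run_estimate hθ hθ1 hc hσ0 hσ2 (z := z) (p := P.multiplier θ c z) rfl
    (fun _ _ => rfl) hmono).2
  have hrk : ∀ k < K + 1, ‖v (k + 1) + z k - z (k + 1)‖
      ≤ √(3 * IPAAL.kappa θ * P.R0 lam cbar (z 0)) := by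
    intro k hk
    refine Real.le_sqrt_of_sq_le (le_trans ?_ hQ)
    exact Finset.single_le_sum (f := fun k => ‖v (k + 1) + z k - z (k + 1)‖ ^ 2)
      (fun _ _ => sq_nonneg _) (Finset.mem_range.2 hk)
  have hdk : ∀ k < K + 1, (lam * P.Lc L c + 1) * ‖zh (k + 1) - z (k + 1)‖
      ≤ ‖v (k + 1) + z k - z (k + 1)‖ := fun k hk =>
    hA.norm_refinement_le hc0.le hlam hσ0 hσ1
      (hA.refinement_inexactStep hint hc0.le hlam hσ0 hσ4 (hst k hk) (hsteps k hk).2.1).2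
  have hlev : ∀ k < K + 1, zh (k + 1) ∈
      IPAAL.sublevel (P.phi cbar) (P.level θ lam cbar zbar (z 0)) := by
    intro k hk
    obtain ⟨⟨ε', hε'⟩, -⟩ :=
      hA.refinement_inexactStep hint hc0.le hlam hσ0 hσ4 (hst k hk) (hsteps k hk).2.1
    -- The run is cut after step `k + 1` and its last iterate is replaced by the refined point; the
    -- multipliers up to index `k` are unaffected, so the steps remain valid.
    set z' := Function.update z (k + 1) (zh (k + 1)) with hz'_def
    have hz' : ∀ i ≤ k, z i = z' i := fun i hi => by
      rw [hz'_def, Function.update_of_ne (by omega)]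
    have hz'k : z' (k + 1) = zh (k + 1) := Function.update_self ..
    have hrun := (hA.run_estimate hθ hθ1 hc hσ0 hσ2 (z := z') (p := P.multiplier θ c z') (v := v)
      (ε := Function.update ε (k + 1) ε') (N := k) rfl (fun _ _ => rfl) (fun i hi => by
        have hi' : i ≤ k := by omega
        rw [← hz' i hi', ← IPAAL.Problem.multiplier_congr fun j hj => hz' j (hj.trans hi')]
        rcases hi'.eq_or_lt with rfl | hlt
        · rw [hz'k, Function.update_self, ← hpm i hk]
          exact hε'
        · rw [← hz' (i + 1) hlt, Function.update_of_ne (by omega)]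
          exact hmono i (by omega))).1
    rw [hz'k, ← hz' 0 (Nat.zero_le _)] at hrun
    exact hA.mem_sublevel_level hlam (interior_subset hzbar) hε'.mem hrun
  have hσp := P.sigmaPlus_pos hA.A_ne_zero
  have hph : ∀ k < K + 1, P.sigmaPlus * ‖ph (k + 1)‖ ≤
      max (P.stepBound L θ lam cbar zbar (z 0)) (P.sigmaPlus * ((1 - θ) * ‖p k‖)) := by
    intro k hk
    rw [(hsteps k hk).2.2]
    rcases le_total ‖(1 - θ) • p k + c • (P.A (zh (k + 1)) - P.b)‖ ‖(1 - θ) • p k‖ with h | h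
    · refine le_max_of_le_right ?_
      rw [norm_smul, Real.norm_of_nonneg (by linarith)] at h
      gcongr
    · refine le_max_of_le_left ?_
      exact hA.refined_multiplier_bound hzbar hzb hc0 hlam hκ hz₀ hB2 hB3
        (by rw [hpm k hk]; exact IPAAL.Problem.multiplier_mem_range hzb z k) (hst k hk).mem
        (hsteps k hk).2.1 (hdk k hk) (hrk k hk) (hlev k hk) h
  have hb0 := fun β (hβ : θ * β ^ 2 ≤ 3 * IPAAL.kappa θ * P.R0 lam cbar (z 0)) =>
    hA.stepBound_add_le (zbar := zbar) hθ hθ1 hlam hβ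
  have hQ0 : 0 ≤ 3 * IPAAL.kappa θ * P.R0 lam cbar (z 0) :=
    mul_nonneg (by positivity) (hA.R0_nonneg hlam)
  have hsb : 0 ≤ P.stepBound L θ lam cbar zbar (z 0) := (hb0 0 (by simpa using hQ0)).1
  have hpk : ∀ k < K + 1, ∃ β : ℝ, 0 ≤ β ∧
      θ * β ^ 2 ≤ ∑ i ∈ Finset.range k, ‖v (i + 1) + z i - z (i + 1)‖ ^ 2 ∧
      P.sigmaPlus * ‖p k‖ ≤ P.stepBound L θ lam cbar zbar (z 0) + β / lam := by
    intro k
    induction k with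
    | zero =>
      intro _
      exact ⟨0, le_rfl, by simp, by simpa [hp0] using hsb⟩
    | succ k ih =>
      intro hk
      obtain ⟨β, hβ0, hβ, hpβ⟩ := ih (by omega)
      have h1θ : 0 ≤ 1 - θ := by linarith
      -- The accumulated error decays with the old multiplier and gains the new residual, while
      -- `stepBound`, being inside a maximum, is not accumulated.
      refine ⟨(1 - θ) * β + ‖v (k + 1) + z k - z (k + 1)‖,
        add_nonneg (mul_nonneg h1θ hβ0) (norm_nonneg _), ?_, ?_⟩
      · rw [Finset.sum_range_succ]
        exact IPAAL.discounted_sum_bound hθ hθ1 hβ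
      · have h1 := hph k (by omega)
        have h2 := hA.sigmaPlus_mul_refinement_gap_le hc0 hlam (hdk k (by omega))
        have e : p (k + 1) = ph (k + 1) + c • P.A (z (k + 1) - zh (k + 1)) := by
          rw [(hcont k (by omega)).2, (hsteps k (by omega)).2.2, map_sub]
          module
        have h3 : P.sigmaPlus * ‖p (k + 1)‖ ≤ P.sigmaPlus * ‖ph (k + 1)‖
            + P.sigmaPlus * ‖c • P.A (z (k + 1) - zh (k + 1))‖ := by
          rw [← mul_add, e]
          gcongr
          exact norm_add_le _ _
        have h4 : max (P.stepBound L θ lam cbar zbar (z 0)) (P.sigmaPlus * ((1 - θ) * ‖p k‖))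
            ≤ P.stepBound L θ lam cbar zbar (z 0) + (1 - θ) * (β / lam) := by
          have hβl : 0 ≤ (1 - θ) * (β / lam) := by positivity
          refine max_le (by linarith) ?_
          have h5 := mul_le_mul_of_nonneg_left hpβ h1θ
          have h6 := mul_nonneg hθ.le hsb
          linarith
        have e2 : ((1 - θ) * β + ‖v (k + 1) + z k - z (k + 1)‖) / lam
            = (1 - θ) * (β / lam) + ‖v (k + 1) + z k - z (k + 1)‖ / lam := by ring
        rw [e2]
        linarith
  obtain ⟨β, hβ0, hβ, hpβ⟩ := hpk K (by omega)
  have hβQ : θ * β ^ 2 ≤ 3 * IPAAL.kappa θ * P.R0 lam cbar (z 0) := by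
    refine hβ.trans (le_trans ?_ hQ)
    rw [Finset.sum_range_succ]
    exact le_add_of_nonneg_right (sq_nonneg _)
  have hN := (hb0 β hβQ).2
  have hβl : 0 ≤ β / lam := div_nonneg hβ0 hlam.le
  have hpN : ‖p K‖ ≤ P.N0 L θ lam cbar zbar (z 0) :=
    le_of_mul_le_mul_left (hpβ.trans hN) hσp
  have hpK : (1 - θ) * ‖p K‖ ≤ P.N0 L θ lam cbar zbar (z 0) :=
    (mul_le_of_le_one_left (norm_nonneg _) (by linarith)).trans hpN
  have hphN : ‖ph (K + 1)‖ ≤ P.N0 L θ lam cbar zbar (z 0) := by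
    refine le_of_mul_le_mul_left ((hph K (by omega)).trans (max_le (by linarith) ?_)) hσp
    gcongr
  obtain ⟨-, hrefine, hphK⟩ := hsteps K (by omega)
  refine ⟨?_, hresid, ?_⟩
  · rw [hphK]
    exact hA.refinement_subgradient hint hlam (hst K (by omega)).mem hrefine
  · rw [le_div_iff₀ hc0]
    have e : c • (P.A (zh (K + 1)) - P.b) = ph (K + 1) - (1 - θ) • p K := by
      rw [hphK]; abel
    calc ‖P.A (zh (K + 1)) - P.b‖ * c = ‖c • (P.A (zh (K + 1)) - P.b)‖ := by
          rw [norm_smul, Real.norm_of_nonneg hc0.le, mul_comm]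
      _ ≤ ‖ph (K + 1)‖ + ‖(1 - θ) • p K‖ := by rw [e]; exact norm_sub_le _ _
      _ ≤ 2 * P.N0 L θ lam cbar zbar (z 0) := by
          rw [norm_smul, Real.norm_of_nonneg (by linarith)]
          linarith
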